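/- **Mechanisms.** Consider a planar four-bar mechanism with link lengths $l_1,l_2,l_3>0$ and base length $d>0$. In the complex plane, link 1 goes from $0$ to $l_1z_1$, link 2 from $d$ to $d+l_2z_2$, and link 3 from $l_1z_1$ to $d+l_2z_2$ in the direction $z_3$, where $|z_1|=|z_2|=|z_3|=1$. Thus $z_3=G_1z_1+G_2z_2+G_3$ with $G_1=-l_1/l_3$, $G_2=l_2/l_3$, $G_3=d/l_3$. The configurations are the pairs $(z_1,z_2)$ of unit complex numbers with $G(z_1,z_2)=0$, where $$G=(G_1z_1+G_2z_2+G_3)(G_1z_1^{-1}+G_2z_2^{-1}+G_3)-1$$ is the loop-closure polynomial, a Laurent polynomial over $\mathbb C$. Link $i$ has mass $m_i>0$, moment of inertia $I_i>0$ about its centre of mass, and centre of mass at $r_ip_iz_i$ from the starting point of the link, with $r_i\ge 0$ and $|p_i|=1$. Put $q_i=m_ir_ip_i$, $J_i=I_i+m_ir_i^2$, and $$F_1=q_1+m_3l_1+G_1q_3,\qquad F_2=q_2+G_2q_3 .$$ **Balancing.** Let $S$ be a set of configurations. The mechanism is *statically balanced on $S$* if its centre of mass is the same point for all configurations in $S$.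 It is *dynamically balanced on $S$* if it is statically balanced on $S$ and, in every configuration in $S$, its total angular momentum is $0$ for all joint angular velocities $\omega_1,\omega_2,\omega_3\in\mathbb R$ that satisfy the differentiated closure equation $z_3\omega_3=G_1z_1\omega_1+G_2z_2\omega_2$. Dynamic balancing is *possible* for given lengths in a given mode (a set of configurations described by a condition on $z_1,z_2$) if some mechanism with these lengths is dynamically balanced on some infinite set of configurations in that mode. **Theorem.** $G$ is irreducible in $\mathbb C[z_1^{\pm1},z_2^{\pm1}]$ if and only if none of the relations (II) $l_1=l_2,\ l_3=d$; (III) $l_1=d,\ l_2=l_3$; (IV) $l_2=d,\ l_1=l_3$ holds. Moreover, let $S$ be any infinite set of configurations of a mechanism. * *Irreducible case.* If $G$ is irreducible, the mechanism is statically balanced on $S$ iff $F_1=F_2=0$, and it is not dynamically balanced on $S$. * *II-A.* If $l_1=l_2=:l$, $l_3=d$, $l\ne d$ and $z_1\ne z_2$ on $S$, it is statically balanced on $S$ iff $F_1=F_2=0$, and dynamically balanced on $S$ iff $$q_1=\tfrac ld q_3-lm_3,\quad q_2=-\tfrac ld q_3,\quad J_1=\tfrac{d^2+l^2}{d}q_3-J_3-l^2m_3,\quad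 J_2=\tfrac{d^2-l^2}{d}q_3-J_3 .$$ * *II-B (parallelogram).* If $l_1=l_2$, $l_3=d$ and $z_1=z_2$ on $S$, it is statically balanced on $S$ iff $F_1+F_2=0$, and it is not dynamically balanced on $S$. * *III-A.* If $l_1=d$, $l_2=l_3=:l$, $l\ne d$ and $z_1\ne1$ on $S$, it is statically balanced on $S$ iff $F_1=F_2=0$, and dynamically balanced on $S$ iff $$q_1=\tfrac dl q_3-dm_3,\quad q_2=-q_3,\quad J_1=\tfrac{d^2+l^2}{l}q_3-J_3-d^2m_3,\quad J_2=J_3-2l\,q_3 .$$ * *III-B (deltoid).* If $l_1=d$, $l_2=l_3$ and $z_1=1$ on $S$, it is statically balanced on $S$ iff $F_2=0$, and it is not dynamically balanced on $S$. * *IV-A.* If $l_2=d$, $l_1=l_3=:l$, $l\ne d$ and $z_2\ne-1$ on $S$, it is statically balanced on $S$ iff $F_1=F_2=0$, and dynamically balanced on $S$ iff $$q_1=q_3-lm_3,\quad q_2=-\tfrac dl q_3,\quad J_1=J_3-l^2m_3,\quad J_2=\tfrac{l^2-d^2}{l}q_3-J_3 .$$ * *IV-B (deltoid).* If $l_2=d$,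 $l_1=l_3$ and $z_2=-1$ on $S$, it is statically balanced on $S$ iff $F_1=0$, and it is not dynamically balanced on $S$. * *V.* If $l_1=l_2=l_3=d$, every configuration satisfies $z_1=z_2$ or $z_1=1$ or $z_2=-1$, and the mechanism is not dynamically balanced on $S$. Finally, let $l,d>0$. Dynamic balancing is possible for $l_1=l_2=l$, $l_3=d$ in the mode $z_1\ne z_2$ iff $d>\sqrt2\,l$; for $l_1=d$, $l_2=l_3=l$ in the mode $z_1\neq 1$ iff $d>\sqrt2\,l$; and for $l_2=d$, $l_1=l_3=l$ in the mode $z_2\ne-1$ iff $d>\sqrt2\,l$. -/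

import Mathlib

open scoped LaurentPolynomial

noncomputable section

/-- A planar four-bar mechanism. The base joins the fixed points `0` and `d`. Link `1` goes from `0`
to `l1 z1`, link `2` from `d` to `d + l2 z2`, and link `3` (the coupler) from `l1 z1` to `d + l2 z2`,
in the direction `z3`. In its own frame, link `i` has its centre of mass at `r i * p i`, seen from
its starting point, with `p i` a unit complex number; `m i` is its mass and `I i` its moment of
inertia about its centre of mass. -/
structure FourBar where
  (l1 l2 l3 d : ℝ)
  (m1 m2 m3 : ℝ)
  (r1 r2 r3 : ℝ)
  (p1 p2 p3 : ℂ)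
  (I1 I2 I3 : ℝ)
  l1_pos : 0 < l1
  l2_pos : 0 < l2
  l3_pos : 0 < l3
  d_pos : 0 < d
  m1_pos : 0 < m1
  m2_pos : 0 < m2
  m3_pos : 0 < m3
  r1_nonneg : 0 ≤ r1
  r2_nonneg : 0 ≤ r2
  r3_nonneg : 0 ≤ r3
  norm_p1 : ‖p1‖ = 1
  norm_p2 : ‖p2‖ = 1
  norm_p3 : ‖p3‖ = 1
  I1_pos : 0 < I1
  I2_pos : 0 < I2
  I3_pos : 0 < I3

namespace FourBar

variable (B : FourBar)

/-! ### Kinematics -/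

/-- Coefficients of the closure constraint `z3 = G1 z1 + G2 z2 + G3`. -/
def G1 : ℝ := -B.l1 / B.l3

/-- See `FourBar.G1`. -/
def G2 : ℝ := B.l2 / B.l3

/-- See `FourBar.G1`. -/
def G3 : ℝ := B.d / B.l3

/-- The loop-closure polynomial
`(G1 z1 + G2 z2 + G3) (G1 z1⁻¹ + G2 z2⁻¹ + G3) - 1` as a Laurent polynomial in two variables over
`ℂ`, where `ℂ[z1, z1⁻¹, z2, z2⁻¹]` is built as `(ℂ[z1, z1⁻¹])[z2, z2⁻¹]`. -/
def loopPoly : ℂ[T;T⁻¹][T;T⁻¹] :=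
  let z1 : ℤ → ℂ[T;T⁻¹][T;T⁻¹] := fun n => LaurentPolynomial.C (LaurentPolynomial.T n)
  let z2 : ℤ → ℂ[T;T⁻¹][T;T⁻¹] := fun n => LaurentPolynomial.T n
  let const : ℝ → ℂ[T;T⁻¹][T;T⁻¹] :=
    fun a => LaurentPolynomial.C (LaurentPolynomial.C (a : ℂ))
  (const B.G1 * z1 1 + const B.G2 * z2 1 + const B.G3) *
    (const B.G1 * z1 (-1) + const B.G2 * z2 (-1) + const B.G3) - 1

/-- The value of the loop-closure polynomial at `(z1, z2)`. -/
def G (z : ℂ × ℂ) : ℂ :=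
  (B.G1 * z.1 + B.G2 * z.2 + B.G3) * (B.G1 * z.1⁻¹ + B.G2 * z.2⁻¹ + B.G3) - 1

/-- The configurations of the mechanism: pairs `(z1, z2)` of unit complex numbers with
`G (z1, z2) = 0`. -/
def configs : Set (ℂ × ℂ) := {z | ‖z.1‖ = 1 ∧ ‖z.2‖ = 1 ∧ B.G z = 0}

/-- The direction of the coupler. -/
def z3 (z : ℂ × ℂ) : ℂ := B.G1 * z.1 + B.G2 * z.2 + B.G3

/-- `(ω1, ω2, ω3)` are joint angular velocities that the mechanism can have in the configuration
`z`: they satisfy the time derivative of the closure constraint. -/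
def IsVelocity (z : ℂ × ℂ) (ω1 ω2 ω3 : ℝ) : Prop :=
  B.z3 z * ω3 = B.G1 * z.1 * ω1 + B.G2 * z.2 * ω2

/-! ### Centres of mass and angular momentum -/

/-- Position of the centre of mass of link `1`. -/
def pos1 (z : ℂ × ℂ) : ℂ := B.r1 * B.p1 * z.1

/-- Position of the centre of mass of link `2`. -/
def pos2 (z : ℂ × ℂ) : ℂ := B.d + B.r2 * B.p2 * z.2

/-- Position of the centre of mass of link `3`. -/
def pos3 (z : ℂ × ℂ) : ℂ := B.l1 * z.1 + B.r3 * B.p3 * B.z3 z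

/-- Velocity of the centre of mass of link `1`. -/
def vel1 (z : ℂ × ℂ) (ω1 : ℝ) : ℂ := Complex.I * (B.r1 * B.p1 * z.1 * ω1)

/-- Velocity of the centre of mass of link `2`. -/
def vel2 (z : ℂ × ℂ) (ω2 : ℝ) : ℂ := Complex.I * (B.r2 * B.p2 * z.2 * ω2)

/-- Velocity of the centre of mass of link `3`. -/
def vel3 (z : ℂ × ℂ) (ω1 ω3 : ℝ) : ℂ :=
  Complex.I * (B.l1 * z.1 * ω1 + B.r3 * B.p3 * B.z3 z * ω3)

/-- The centre of mass of the mechanism. -/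
def centreOfMass (z : ℂ × ℂ) : ℂ :=
  (B.m1 * B.pos1 z + B.m2 * B.pos2 z + B.m3 * B.pos3 z) / (B.m1 + B.m2 + B.m3)

/-- The total angular momentum: the sum over the three links of
`m ⟨position, -i * velocity⟩ + I * ω`. -/
def angularMomentum (z : ℂ × ℂ) (ω1 ω2 ω3 : ℝ) : ℝ :=
  (B.m1 * inner ℝ (B.pos1 z) (-Complex.I * B.vel1 z ω1) + B.I1 * ω1) +
  (B.m2 * inner ℝ (B.pos2 z) (-Complex.I * B.vel2 z ω2) + B.I2 * ω2) +
  (B.m3 * inner ℝ (B.pos3 z) (-Complex.I * B.vel3 z ω1 ω3) + B.I3 * ω3)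

/-! ### Balancing -/

/-- The centre of mass is stationary on the set `S` of configurations. -/
def StaticallyBalancedOn (S : Set (ℂ × ℂ)) : Prop :=
  ∃ c : ℂ, ∀ z ∈ S, B.centreOfMass z = c

/-- The mechanism is statically balanced on `S`, and its angular momentum vanishes in every
configuration in `S` for all joint angular velocities that are possible there. -/
def DynamicallyBalancedOn (S : Set (ℂ × ℂ)) : Prop :=
  B.StaticallyBalancedOn S ∧
    ∀ z ∈ S, ∀ ω1 ω2 ω3 : ℝ, B.IsVelocity z ω1 ω2 ω3 → B.angularMomentum z ω1 ω2 ω3 = 0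

/-! ### Parameters in which the balancing conditions are expressed -/

/-- `q i = m i * r i * p i`. -/
def q1 : ℂ := B.m1 * B.r1 * B.p1

/-- See `FourBar.q1`. -/
def q2 : ℂ := B.m2 * B.r2 * B.p2

/-- See `FourBar.q1`. -/
def q3 : ℂ := B.m3 * B.r3 * B.p3

/-- `J i = I i + m i * r i ^ 2`. -/
def J1 : ℝ := B.I1 + B.m1 * B.r1 ^ 2

/-- See `FourBar.J1`. -/
def J2 : ℝ := B.I2 + B.m2 * B.r2 ^ 2

/-- See `FourBar.J1`. -/
def J3 : ℝ := B.I3 + B.m3 * B.r3 ^ 2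

/-- The coefficient of `z1` in the total mass times the centre of mass. -/
def F1 : ℂ := B.m1 * B.r1 * B.p1 + B.m3 * B.l1 + B.G1 * B.m3 * B.r3 * B.p3

/-- The coefficient of `z2` in the total mass times the centre of mass. -/
def F2 : ℂ := B.m2 * B.r2 * B.p2 + B.G2 * B.m3 * B.r3 * B.p3

/-! ### Kinematic cases -/

/-- Parallelogram or antiparallelogram lengths. -/
def CaseII : Prop := B.l1 = B.l2 ∧ B.l3 = B.d

/-- Deltoid lengths, with `l1 = d`. -/
def CaseIII : Prop := B.l1 = B.d ∧ B.l2 = B.l3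

/-- Deltoid lengths, with `l2 = d`. -/
def CaseIV : Prop := B.l2 = B.d ∧ B.l1 = B.l3

/-- All four lengths are equal. -/
def CaseV : Prop := B.l1 = B.l2 ∧ B.l2 = B.l3 ∧ B.l3 = B.d

/-- The linear balancing conditions for `l1 = l2 = l`, `l3 = d`, in the mode `z1 ≠ z2`. -/
def LinearConditionsII (l : ℝ) : Prop :=
  B.q1 = l / B.d * B.q3 - l * B.m3 ∧
  B.q2 = -(l / B.d) * B.q3 ∧
  (B.J1 : ℂ) = (B.d ^ 2 + l ^ 2) / B.d * B.q3 - B.J3 - l ^ 2 * B.m3 ∧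
  (B.J2 : ℂ) = (B.d ^ 2 - l ^ 2) / B.d * B.q3 - B.J3

/-- The linear balancing conditions for `l1 = d`, `l2 = l3 = l`, in the mode `z1 ≠ 1`. -/
def LinearConditionsIII (l : ℝ) : Prop :=
  B.q1 = B.d / l * B.q3 - B.d * B.m3 ∧
  B.q2 = -B.q3 ∧
  (B.J1 : ℂ) = (B.d ^ 2 + l ^ 2) / l * B.q3 - B.J3 - B.d ^ 2 * B.m3 ∧
  (B.J2 : ℂ) = B.J3 - 2 * l * B.q3

/-- The linear balancing conditions for `l2 = d`, `l1 = l3 = l`, in the mode `z2 ≠ -1`. -/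
def LinearConditionsIV (l : ℝ) : Prop :=
  B.q1 = B.q3 - l * B.m3 ∧
  B.q2 = -(B.d / l) * B.q3 ∧
  (B.J1 : ℂ) = B.J3 - l ^ 2 * B.m3 ∧
  (B.J2 : ℂ) = (l ^ 2 - B.d ^ 2) / l * B.q3 - B.J3

end FourBar

/-- Dynamic balancing is possible for the lengths `l1, l2, l3, d` in the kinematic mode `M`: some
mechanism with these lengths is dynamically balanced on an infinite set of configurations in `M`. -/
def DynamicBalancingPossible (l1 l2 l3 d : ℝ) (M : Set (ℂ × ℂ)) : Prop :=
  ∃ B : FourBar, B.l1 = l1 ∧ B.l2 = l2 ∧ B.l3 = l3 ∧ B.d = d ∧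
    ∃ S : Set (ℂ × ℂ), S ⊆ B.configs ∩ M ∧ S.Infinite ∧ B.DynamicallyBalancedOn S

end

/-!
The configurations form the real part of the curve `x y G(x, y) = 0`, which is quadratic in `y`.
Put `a, b, c = l1, l2, l3` and let `v = |d - a x| ^ 2`, the square of the diagonal from the end of
link `1` to the start of link `2`. As `v = (d - a x) (d - a / x)`, it is a rational function of
`x`.

*Irreducibility.* The discriminant of the quadratic is, up to powers of `x`, the product of
`v - (b + c) ^ 2` and `v - (b - c) ^ 2`, which are coprime. It is a square only if both factors
have a double zero, that is, if `{(a + d) ^ 2, (a - d) ^ 2} = {(b + c) ^ 2, (b - c) ^ 2}`; for positive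
lengths this means `CaseII` or `CaseIV`. The coefficients have a common zero only in `CaseIII`.
Conversely the special cases have explicit factorizations (`FourBar.irreducible_loopPoly_iff`).

*Static balance.* It says that `F1 z1 + F2 z2` is constant on `S`. A line of this form meets the
unit torus in infinitely many points only along `z1 = k`, `z2 = k` or `z2 = k z1`, and the
quadratic equation shows when one of these lies in the configuration curve
(`FourBar.StaticallyBalancedOn.cases`).

*No dynamic balance outside the special cases.* The velocities include the vector of cross
products of the links. For it, the angular momentum times `v` is a combination of `1, σ, τ, σ τ` with
coefficients in `ℝ[v]`, where `σ` and `τ` are proportional to the areas of the two triangles cut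
off by the diagonal (`angularMomentum_expansion`). By Heron's formula `σ ^ 2` and `τ ^ 2` are
quadratic polynomials in `v` with zeros `(a ± d) ^ 2` and `(b ± c) ^ 2`, so `1, σ, τ, σ τ` are
independent over `ℝ[v]` unless `CaseII` or `CaseIV` holds (`Polynomial.eq_zero_of_biquadratic`). The
vanishing of the coefficients contradicts the positivity of `J2` and `J3`, except in `CaseIII`
(`FourBar.not_dynamicallyBalancedOn`).

*The special cases.* In the degenerate modes one link is at rest or two links are parallel, and
the constant term of the angular momentum is a total moment of inertia, which is positive. In the
other modes two of the directions `z1, z2, z3, -z1` are related by `Y ↦ (l Y + d) / (l + d Y)`.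
This gives the ratios of the velocities (`moebius_velocity_iff`), the angular momentum becomes a
trigonometric polynomial in one variable, and its coefficients are the linear conditions. These
can be satisfied with `J_i > |q_i| ^ 2 / m_i` exactly if `q3 / m3` can be chosen in an interval
that is nonempty for `d ^ 2 > 2 l ^ 2`.
-/

/-! ### Polynomials: squares, quadratic independence, and zeros on the unit circle -/

/-- A polynomial with a simple root is not a square in the field of rational functions. -/
theorem Polynomial.eq_zero_of_sq_eq_mul_sq {K : Type*} [Field K] {N p q : Polynomial K} {r : K}
    (hr : N.eval r = 0) (hr' : N.derivative.eval r ≠ 0) (h : p ^ 2 = N * q ^ 2) : q = 0 := by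
  by_contra hq
  obtain ⟨M, rfl⟩ := Polynomial.dvd_iff_isRoot.2 hr
  have hM : M.eval r ≠ 0 := by
    simpa [Polynomial.derivative_mul] using hr'
  have hM0 : M ≠ 0 := by rintro rfl; simp at hM
  have hX : (Polynomial.X - Polynomial.C r) ≠ 0 := Polynomial.X_sub_C_ne_zero r
  have h1 := congrArg (Polynomial.rootMultiplicity r) h
  rw [Polynomial.rootMultiplicity_mul (mul_ne_zero (mul_ne_zero hX hM0) (pow_ne_zero 2 hq)),
    Polynomial.rootMultiplicity_mul (mul_ne_zero hX hM0),
    Polynomial.rootMultiplicity_X_sub_C_self, Polynomial.rootMultiplicity_eq_zero hM,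
    sq, sq, Polynomial.rootMultiplicity_mul (mul_ne_zero hq hq)] at h1
  rcases eq_or_ne p 0 with rfl | hp
  · exact mul_ne_zero (mul_ne_zero hX hM0) (pow_ne_zero 2 hq) (by rw [← h]; ring)
  · rw [Polynomial.rootMultiplicity_mul (mul_ne_zero hp hp)] at h1
    omega

theorem Polynomial.eq_zero_and_eq_zero_of_sq_eq_mul_sq {K : Type*} [Field K]
    {N p q : Polynomial K} (hN : ∃ r, N.eval r = 0 ∧ N.derivative.eval r ≠ 0)
    (h : p ^ 2 = N * q ^ 2) : p = 0 ∧ q = 0 := by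
  obtain ⟨r, hr, hr'⟩ := hN
  have hq := eq_zero_of_sq_eq_mul_sq hr hr' h
  subst hq
  exact ⟨by simpa using h, rfl⟩

/-- If `n`, `w` and `n * w` each have a simple root, then `1, √n, √w, √(n w)` are linearly
independent over the polynomials, and a vanishing combination can be recognized from its zeros: it
is enough that it vanishes for infinitely many values of the variable, with some choice of the
square roots for each of them. -/
theorem Polynomial.eq_zero_of_biquadratic {K : Type*} [Field K] [CharZero K]
    {n w f₀ f₁ g₀ g₁ : Polynomial K}
    (hn : ∃ r, n.eval r = 0 ∧ n.derivative.eval r ≠ 0)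
    (hw : ∃ r, w.eval r = 0 ∧ w.derivative.eval r ≠ 0)
    (hnw : ∃ r, (n * w).eval r = 0 ∧ (n * w).derivative.eval r ≠ 0)
    {T : Set K} (hT : T.Infinite)
    (h : ∀ t ∈ T, ∃ σ ω : K, σ ^ 2 = n.eval t ∧ ω ^ 2 = w.eval t ∧
      f₀.eval t + f₁.eval t * σ + g₀.eval t * ω + g₁.eval t * (σ * ω) = 0) :
    f₀ = 0 ∧ f₁ = 0 ∧ g₀ = 0 ∧ g₁ = 0 := by
  -- `(f₀ + f₁ √n) ^ 2 = w (g₀ + g₁ √n) ^ 2`; the two sides are compared over `K[√n]`.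
  have key : (f₀ ^ 2 + n * f₁ ^ 2 - w * (g₀ ^ 2 + n * g₁ ^ 2)) ^ 2 =
      n * (2 * (f₀ * f₁ - w * (g₀ * g₁))) ^ 2 := by
    refine Polynomial.eq_of_infinite_eval_eq _ _ (hT.mono fun t ht => ?_)
    obtain ⟨σ, ω, hσ, hω, h0⟩ := h t ht
    simp only [Set.mem_ofPred_eq, Polynomial.eval_pow, Polynomial.eval_sub, Polynomial.eval_add,
      Polynomial.eval_mul, ← hσ, ← hω, Polynomial.eval_ofNat]
    generalize f₀.eval t = a at *
    generalize f₁.eval t = b at *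
    generalize g₀.eval t = c at *
    generalize g₁.eval t = d at *
    linear_combination (a + b * σ - c * ω - d * (σ * ω)) *
      ((a ^ 2 + σ ^ 2 * b ^ 2 - ω ^ 2 * (c ^ 2 + σ ^ 2 * d ^ 2)) -
        σ * (2 * (a * b - ω ^ 2 * (c * d)))) * h0
  obtain ⟨h1, h2⟩ := eq_zero_and_eq_zero_of_sq_eq_mul_sq hn key
  have h3 : f₀ * f₁ = w * (g₀ * g₁) := by
    simpa [sub_eq_zero] using h2
  have h4 : f₀ ^ 2 + n * f₁ ^ 2 = w * (g₀ ^ 2 + n * g₁ ^ 2) := sub_eq_zero.1 h1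
  have hn0 : n ≠ 0 := by rintro rfl; simp at hn
  -- `f₀ ^ 2` and `n * f₁ ^ 2` have the sum and the product of `w * g₀ ^ 2` and `w * n * g₁ ^ 2`.
  have h5 : (f₀ ^ 2 - w * g₀ ^ 2) * (f₀ ^ 2 - w * n * g₁ ^ 2) = 0 := by
    linear_combination -n * (f₀ * f₁ + w * (g₀ * g₁)) * h3 + f₀ ^ 2 * h4
  rcases mul_eq_zero.1 h5 with h6 | h6
  · obtain ⟨rfl, rfl⟩ := eq_zero_and_eq_zero_of_sq_eq_mul_sq hw (sub_eq_zero.1 h6)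
    have h7 : f₁ ^ 2 = w * g₁ ^ 2 := mul_left_cancel₀ hn0 (by linear_combination h4)
    obtain ⟨rfl, rfl⟩ := eq_zero_and_eq_zero_of_sq_eq_mul_sq hw h7
    simp
  · have h7 : (n * f₁) ^ 2 = n * w * g₀ ^ 2 := by linear_combination n * h4 - n * h6
    obtain ⟨h8, rfl⟩ := eq_zero_and_eq_zero_of_sq_eq_mul_sq hnw h7
    obtain ⟨rfl, rfl⟩ := eq_zero_and_eq_zero_of_sq_eq_mul_sq (p := f₀) (q := g₁) (N := n * w) hnw
      (by linear_combination h6)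
    exact ⟨rfl, (mul_eq_zero.1 h8).resolve_left hn0, rfl, rfl⟩

/-- A polynomial of degree at most four with infinitely many zeros has zero coefficients. -/
theorem quartic_coeffs_eq_zero {K : Type*} [Field K] {T : Set K} (hT : T.Infinite)
    {a b c d e : K} (h : ∀ z ∈ T, a + b * z + c * z ^ 2 + d * z ^ 3 + e * z ^ 4 = 0) :
    a = 0 ∧ b = 0 ∧ c = 0 ∧ d = 0 ∧ e = 0 := by
  open Polynomial in
  have h0 : C a + C b * X + C c * X ^ 2 + C d * X ^ 3 + C e * X ^ 4 = (0 : K[X]) :=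
    Polynomial.eq_zero_of_infinite_isRoot _ (hT.mono fun z hz => by
      simpa [Polynomial.IsRoot.def] using h z hz)
  have hc : ∀ n, (Polynomial.C a + Polynomial.C b * Polynomial.X + Polynomial.C c * Polynomial.X ^ 2
      + Polynomial.C d * Polynomial.X ^ 3 + Polynomial.C e * Polynomial.X ^ 4).coeff n = 0 := by
    simp [h0]
  have h0 := hc 0
  have h1 := hc 1
  have h2 := hc 2
  have h3 := hc 3
  have h4 := hc 4
  simp [Polynomial.coeff_X, Polynomial.coeff_C] at h0 h1 h2 h3 h4
  exact ⟨h0, h1, h2, h3, h4⟩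

theorem quadratic_coeffs_eq_zero {K : Type*} [Field K] {T : Set K} (hT : T.Infinite)
    {a b c : K} (h : ∀ z ∈ T, a + b * z + c * z ^ 2 = 0) : a = 0 ∧ b = 0 ∧ c = 0 := by
  obtain ⟨h0, h1, h2, -, -⟩ := quartic_coeffs_eq_zero hT (a := a) (b := b) (c := c) (d := 0)
    (e := 0) (fun z hz => by simpa using h z hz)
  exact ⟨h0, h1, h2⟩

theorem Complex.conj_mul_of_norm_one {z : ℂ} (hz : ‖z‖ = 1) : starRingEnd ℂ z * z = 1 := by
  rw [mul_comm, Complex.mul_conj, Complex.normSq_eq_norm_sq, hz]; simp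

theorem Complex.sq_add_sq_of_norm_one {z : ℂ} (hz : ‖z‖ = 1) : z.re ^ 2 + z.im ^ 2 = 1 := by
  have := Complex.normSq_eq_norm_sq z
  rw [hz, Complex.normSq_apply] at this
  linarith

/-- A real trigonometric polynomial of degree at most two with infinitely many zeros on the unit
circle has zero coefficients. -/
theorem trigPoly_coeffs_eq_zero {T : Set ℂ} (hT : T.Infinite) (hT1 : ∀ z ∈ T, ‖z‖ = 1)
    {a : ℝ} {b c : ℂ} (h : ∀ z ∈ T, a + (b * z).re + (c * z ^ 2).re = 0) :
    a = 0 ∧ b = 0 ∧ c = 0 := by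
  -- On the unit circle `2 z ^ 2` times the trigonometric polynomial is an honest polynomial.
  obtain ⟨-, -, h2, h3, h4⟩ := quartic_coeffs_eq_zero hT (a := starRingEnd ℂ c)
    (b := starRingEnd ℂ b) (c := 2 * (a : ℂ)) (d := b) (e := c) (fun z hz => by
      have h1 := Complex.conj_mul_of_norm_one (hT1 z hz)
      have h2 : (a : ℂ) + ((b * z).re : ℂ) + ((c * z ^ 2).re : ℂ) = 0 := by
        exact_mod_cast h z hz
      rw [Complex.re_eq_add_conj, Complex.re_eq_add_conj] at h2
      simp only [map_mul, map_pow] at h2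
      linear_combination 2 * z ^ 2 * h2 - (starRingEnd ℂ b * z +
        starRingEnd ℂ c * (starRingEnd ℂ z * z + 1)) * h1)
  exact ⟨by simpa using h2, h3, h4⟩

/-! ### Irreducibility of the loop-closure polynomial -/

namespace LoopClosure

open LaurentPolynomial

/-- The coefficient of `y ^ 2` in `x y` times the closure polynomial
`(-α x + β y + γ) (-α x⁻¹ + β y⁻¹ + γ) - 1`. -/
noncomputable def coeffTwo (α β γ : ℂ) : Polynomial ℂ :=
  Polynomial.C (β * γ) * Polynomial.X - Polynomial.C (α * β)

/-- The coefficient of `y` in `x y` times the closure polynomial. -/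
noncomputable def coeffOne (α β γ : ℂ) : Polynomial ℂ :=
  Polynomial.C (α ^ 2 + β ^ 2 + γ ^ 2 - 1) * Polynomial.X -
    Polynomial.C (α * γ) * (Polynomial.X ^ 2 + 1)

/-- The coefficient of `1` in `x y` times the closure polynomial. -/
noncomputable def coeffZero (α β γ : ℂ) : Polynomial ℂ :=
  Polynomial.X * (Polynomial.C (β * γ) - Polynomial.C (α * β) * Polynomial.X)

/-- `x y` times the closure polynomial, as a polynomial in `y` over `ℂ[x, x⁻¹]`. -/
noncomputable def quad (α β γ : ℂ) : Polynomial ℂ[T;T⁻¹] :=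
  Polynomial.C (Polynomial.toLaurent (coeffTwo α β γ)) * Polynomial.X ^ 2 +
  Polynomial.C (Polynomial.toLaurent (coeffOne α β γ)) * Polynomial.X +
  Polynomial.C (Polynomial.toLaurent (coeffZero α β γ))

/-- The factor `u - s ^ 2 x` of the discriminant, where `u = (γ x - α) (γ - α x)`. -/
noncomputable def discFactor (α γ s : ℂ) : Polynomial ℂ :=
  Polynomial.C (-(α * γ)) * Polynomial.X ^ 2 +
    Polynomial.C (α ^ 2 + γ ^ 2 - s ^ 2) * Polynomial.X + Polynomial.C (-(α * γ))

theorem disc_eq (α β γ : ℂ) :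
    coeffOne α β γ ^ 2 - 4 * coeffTwo α β γ * coeffZero α β γ =
      discFactor α γ (β + 1) * discFactor α γ (β - 1) := by
  simp only [coeffOne, coeffTwo, coeffZero, discFactor, map_mul, map_add, map_sub, map_pow,
    map_neg, map_one]
  ring

/-- If the discriminant has no simple root besides `0`, then both factors have a double root. -/
theorem disc_discFactor_eq_zero {α γ s t : ℂ} (hα : α ≠ 0) (hγ : γ ≠ 0) (hst : s ^ 2 ≠ t ^ 2)
    (h : ∀ r, (discFactor α γ s * discFactor α γ t).eval r = 0 →
      (discFactor α γ s * discFactor α γ t).derivative.eval r = 0) :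
    ((α + γ) ^ 2 - s ^ 2) * ((α - γ) ^ 2 - s ^ 2) = 0 := by
  have hdeg : (discFactor α γ s).degree ≠ 0 := by
    rw [discFactor, Polynomial.degree_quadratic (by simp [hα, hγ])]; simp
  obtain ⟨r, hr⟩ := IsAlgClosed.exists_root _ hdeg
  rw [Polynomial.IsRoot.def] at hr
  have h1 := h r (by rw [Polynomial.eval_mul, hr, zero_mul])
  simp only [Polynomial.derivative_mul, Polynomial.eval_add, Polynomial.eval_mul, hr, zero_mul,
    add_zero, mul_eq_zero] at h1
  simp only [discFactor, Polynomial.eval_add, Polynomial.eval_mul, Polynomial.eval_C,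
    Polynomial.eval_pow, Polynomial.eval_X, Polynomial.derivative_add, Polynomial.derivative_mul,
    Polynomial.derivative_C, Polynomial.derivative_X_pow, Polynomial.derivative_X] at hr h1
  rcases h1 with h1 | h1
  · simp at h1
    linear_combination 4 * α * γ * hr + (α ^ 2 + γ ^ 2 - s ^ 2 - 2 * α * γ * r) * h1
  · exfalso
    have h2 : (s ^ 2 - t ^ 2) * r = 0 := by linear_combination h1 - hr
    rcases mul_eq_zero.1 h2 with h2 | rfl
    · exact hst (sub_eq_zero.1 h2)
    · simp [hα, hγ] at hr

/-- A common divisor of the three coefficients in `ℂ[x, x⁻¹]` is a unit. -/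
theorem isUnit_of_dvd_coeffs {α β γ : ℂ} (hβ : β ≠ 0) (hαγ : α + γ ≠ 0)
    (hIII : ¬ (α = γ ∧ β ^ 2 = 1)) {r : ℂ[T;T⁻¹]}
    (h2 : r ∣ Polynomial.toLaurent (coeffTwo α β γ))
    (h1 : r ∣ Polynomial.toLaurent (coeffOne α β γ))
    (h0 : r ∣ Polynomial.toLaurent (coeffZero α β γ)) : IsUnit r := by
  have hC : ∀ z : ℂ, z ≠ 0 → IsUnit (C z : ℂ[T;T⁻¹]) := fun z hz => hz.isUnit.map C
  simp only [coeffTwo, coeffOne, coeffZero, map_sub, map_mul, map_add, map_pow, map_one,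
    Polynomial.toLaurent_C, Polynomial.toLaurent_X] at h0 h1 h2
  have h3 : r ∣ C β * (C γ - C α * T 1) := by
    refine ((isUnit_T (R := ℂ) 1).dvd_mul_left).1 ?_
    convert h0 using 1
    ring
  by_cases h : α = γ
  · subst h
    have hb : β ^ 2 - 1 ≠ 0 := fun hb => hIII ⟨rfl, by linear_combination hb⟩
    refine isUnit_of_dvd_unit ?_ ((hC _ hb).mul ((hC β hβ).mul (isUnit_T (R := ℂ) 1)))
    have e := (h1.mul_left (C β)).add (h2.mul_left (C α * (T 1 - 1)))
    convert e using 1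
    simp only [map_sub, map_pow, map_one]
    ring
  · have hd : γ ^ 2 - α ^ 2 ≠ 0 := by
      intro hd
      rcases mul_eq_zero.1 (show (γ - α) * (α + γ) = 0 by linear_combination hd) with h' | h'
      · exact h (sub_eq_zero.1 h').symm
      · exact hαγ h'
    refine isUnit_of_dvd_unit ?_ ((hC _ hd).mul (hC β hβ))
    have e := (h2.mul_left (C α)).add (h3.mul_left (C γ))
    convert e using 1
    simp only [map_sub, map_pow]
    ring

theorem coeff_quadratic {R : Type*} [CommRing R] (a b c : R) :
    (Polynomial.C a * Polynomial.X ^ 2 + Polynomial.C b * Polynomial.X +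
      Polynomial.C c).coeff 2 = a ∧
    (Polynomial.C a * Polynomial.X ^ 2 + Polynomial.C b * Polynomial.X +
      Polynomial.C c).coeff 1 = b ∧
    (Polynomial.C a * Polynomial.X ^ 2 + Polynomial.C b * Polynomial.X +
      Polynomial.C c).coeff 0 = c := by
  refine ⟨?_, ?_, ?_⟩ <;> simp [Polynomial.coeff_X, Polynomial.coeff_C]

/-- `quad` has no proper factors: its coefficients have no common factor, and two linear factors
would make its discriminant a square. -/
theorem isUnit_or_isUnit_of_mul_eq_quad {α β γ : ℂ} (hα : α ≠ 0) (hβ : β ≠ 0) (hγ : γ ≠ 0)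
    (hαγ : α + γ ≠ 0) (hIII : ¬ (α = γ ∧ β ^ 2 = 1))
    (hdisc : ¬ (((α + γ) ^ 2 - (β + 1) ^ 2) * ((α - γ) ^ 2 - (β + 1) ^ 2) = 0 ∧
      ((α + γ) ^ 2 - (β - 1) ^ 2) * ((α - γ) ^ 2 - (β - 1) ^ 2) = 0))
    {f g : Polynomial ℂ[T;T⁻¹]} (h : f * g = quad α β γ) : IsUnit f ∨ IsUnit g := by
  set p2 := Polynomial.toLaurent (coeffTwo α β γ) with hp2
  set p1 := Polynomial.toLaurent (coeffOne α β γ) with hp1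
  set p0 := Polynomial.toLaurent (coeffZero α β γ) with hp0
  have hp2n : p2 ≠ 0 := by
    rw [hp2, Polynomial.toLaurent_ne_zero]
    intro h0
    have := congrArg (Polynomial.eval 0) h0
    simp [coeffTwo, hα, hβ] at this
  have hdeg : (quad α β γ).natDegree = 2 := Polynomial.natDegree_quadratic hp2n
  have hne : f * g ≠ 0 := by
    rw [h]; rintro h0; rw [h0] at hdeg; simp at hdeg
  have hdfg : f.natDegree + g.natDegree = 2 := by
    rw [← Polynomial.natDegree_mul (left_ne_zero_of_mul hne) (right_ne_zero_of_mul hne), h, hdeg]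
  have hcoef : (quad α β γ).coeff 2 = p2 ∧ (quad α β γ).coeff 1 = p1 ∧
      (quad α β γ).coeff 0 = p0 := by
    exact coeff_quadratic p2 p1 p0
  -- A factor of degree zero divides the content.
  have hconst : ∀ f g : Polynomial ℂ[T;T⁻¹], f * g = quad α β γ → f.natDegree = 0 → IsUnit f := by
    intro f g h hf
    rw [Polynomial.eq_C_of_natDegree_eq_zero hf] at h ⊢
    refine Polynomial.isUnit_C.2 (isUnit_of_dvd_coeffs hβ hαγ hIII ?_ ?_ ?_)
    · rw [← hp2, ← hcoef.1, ← h, Polynomial.coeff_C_mul]; exact dvd_mul_right _ _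
    · rw [← hp1, ← hcoef.2.1, ← h, Polynomial.coeff_C_mul]; exact dvd_mul_right _ _
    · rw [← hp0, ← hcoef.2.2, ← h, Polynomial.coeff_C_mul]; exact dvd_mul_right _ _
  have hcases : f.natDegree = 0 ∨ g.natDegree = 0 ∨ (f.natDegree = 1 ∧ g.natDegree = 1) := by omega
  rcases hcases with hf | hg | ⟨hf, hg⟩
  · exact Or.inl (hconst f g h hf)
  · exact Or.inr (hconst g f (by rw [mul_comm, h]) hg)
  -- Two linear factors make the discriminant a square.
  exfalso
  obtain ⟨a, b, rfl⟩ : ∃ a b, f = Polynomial.C a * Polynomial.X + Polynomial.C b :=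
    ⟨_, _, Polynomial.eq_X_add_C_of_natDegree_le_one hf.le⟩
  obtain ⟨c, d, rfl⟩ : ∃ c d, g = Polynomial.C c * Polynomial.X + Polynomial.C d :=
    ⟨_, _, Polynomial.eq_X_add_C_of_natDegree_le_one hg.le⟩
  have hexp : (Polynomial.C a * Polynomial.X + Polynomial.C b) *
      (Polynomial.C c * Polynomial.X + Polynomial.C d) = Polynomial.C (a * c) * Polynomial.X ^ 2 +
      Polynomial.C (a * d + b * c) * Polynomial.X + Polynomial.C (b * d) := by
    simp only [map_mul, map_add]; ring
  rw [hexp] at h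
  have e2 : a * c = p2 := by
    rw [← hcoef.1, ← h]; exact (coeff_quadratic _ _ _).1.symm
  have e1 : a * d + b * c = p1 := by
    rw [← hcoef.2.1, ← h]; exact (coeff_quadratic _ _ _).2.1.symm
  have e0 : b * d = p0 := by
    rw [← hcoef.2.2, ← h]; exact (coeff_quadratic _ _ _).2.2.symm
  have hsq : Polynomial.toLaurent (discFactor α γ (β + 1) * discFactor α γ (β - 1)) =
      (a * d - b * c) ^ 2 := by
    rw [← disc_eq]
    simp only [map_sub, map_mul, map_pow, map_ofNat, ← hp0, ← hp1, ← hp2, ← e0, ← e1, ← e2]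
    ring
  obtain ⟨n, W, hW⟩ := exists_T_pow (a * d - b * c)
  have hW2 : W ^ 2 = discFactor α γ (β + 1) * discFactor α γ (β - 1) * (Polynomial.X ^ n) ^ 2 := by
    apply Polynomial.toLaurent_injective
    rw [map_pow, hW, map_mul, hsq, map_pow, Polynomial.toLaurent_X_pow]
    ring
  have hroot : ∀ r, (discFactor α γ (β + 1) * discFactor α γ (β - 1)).eval r = 0 →
      (discFactor α γ (β + 1) * discFactor α γ (β - 1)).derivative.eval r = 0 := by
    intro r hr
    by_contra hr'
    exact pow_ne_zero n Polynomial.X_ne_zero (Polynomial.eq_zero_of_sq_eq_mul_sq hr hr' hW2)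
  have hst : (β + 1) ^ 2 ≠ (β - 1) ^ 2 := fun h' => hβ (by linear_combination h' / 4)
  refine hdisc ⟨disc_discFactor_eq_zero hα hγ hst hroot,
    disc_discFactor_eq_zero hα hγ hst.symm ?_⟩
  simpa only [mul_comm (discFactor α γ (β - 1))] using hroot

/-- The polynomial `y` does not divide `quad`, so that nothing is lost when the powers of `y` in the
factors are cancelled. -/
theorem isUnit_or_isUnit_of_mul_eq_toLaurent_quad {α β γ : ℂ} (hα : α ≠ 0) (hβ : β ≠ 0)
    (hγ : γ ≠ 0) (hαγ : α + γ ≠ 0) (hIII : ¬ (α = γ ∧ β ^ 2 = 1))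
    (hdisc : ¬ (((α + γ) ^ 2 - (β + 1) ^ 2) * ((α - γ) ^ 2 - (β + 1) ^ 2) = 0 ∧
      ((α + γ) ^ 2 - (β - 1) ^ 2) * ((α - γ) ^ 2 - (β - 1) ^ 2) = 0))
    {f g : ℂ[T;T⁻¹][T;T⁻¹]} (h : f * g = Polynomial.toLaurent (quad α β γ)) :
    IsUnit f ∨ IsUnit g := by
  obtain ⟨m, F, hF⟩ := exists_T_pow f
  obtain ⟨n, G, hG⟩ := exists_T_pow g
  have hFG : F * G = quad α β γ * Polynomial.X ^ (m + n) := by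
    apply Polynomial.toLaurent_injective
    rw [map_mul, hF, hG, map_mul, Polynomial.toLaurent_X_pow, ← h]
    push_cast
    rw [T_add]
    ring
  obtain ⟨i, j, b, c, -, hbc, rfl, rfl⟩ := mul_eq_mul_prime_pow Polynomial.prime_X hFG
  have hu : ∀ (b : Polynomial ℂ[T;T⁻¹]) (i k : ℕ) (f : ℂ[T;T⁻¹][T;T⁻¹]),
      Polynomial.toLaurent (b * Polynomial.X ^ i) = f * T k → IsUnit b → IsUnit f := by
    intro b i k f hf hb
    refine isUnit_of_mul_isUnit_left (y := T k) ?_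
    rw [← hf, map_mul, Polynomial.toLaurent_X_pow]
    exact (hb.map _).mul (isUnit_T _)
  rcases isUnit_or_isUnit_of_mul_eq_quad hα hβ hγ hαγ hIII hdisc hbc.symm with hb | hc
  · exact Or.inl (hu b i m f hF hb)
  · exact Or.inr (hu c j n g hG hc)

/-- Evaluation of a Laurent polynomial in two variables at a pair of nonzero numbers. -/
noncomputable def evalAt (x y : ℂˣ) : ℂ[T;T⁻¹][T;T⁻¹] →+* ℂ :=
  LaurentPolynomial.eval₂ (LaurentPolynomial.eval₂ (RingHom.id ℂ) x) y

@[simp] theorem evalAt_C_C (x y : ℂˣ) (z : ℂ) : evalAt x y (C (C z)) = z := by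
  simp [evalAt]

@[simp] theorem evalAt_C_T (x y : ℂˣ) (n : ℤ) : evalAt x y (C (T n)) = ((x ^ n : ℂˣ) : ℂ) := by
  simp [evalAt]

@[simp] theorem evalAt_T (x y : ℂˣ) (n : ℤ) : evalAt x y (T n) = ((y ^ n : ℂˣ) : ℂ) := by
  simp [evalAt]

theorem not_isUnit_of_evalAt_eq_zero {f : ℂ[T;T⁻¹][T;T⁻¹]} (x y : ℂˣ) (h : evalAt x y f = 0) :
    ¬ IsUnit f := fun hf => by
  have := hf.map (evalAt x y)
  rw [h] at this
  exact not_isUnit_zero this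

theorem not_irreducible_of_eq_mul {P f g : ℂ[T;T⁻¹][T;T⁻¹]} (x y : ℂˣ) (h : P = f * g)
    (hf : evalAt x y f = 0) (hg : evalAt x y g = 0) : ¬ Irreducible P := fun hP =>
  (hP.isUnit_or_isUnit h).elim (not_isUnit_of_evalAt_eq_zero x y hf)
    (not_isUnit_of_evalAt_eq_zero x y hg)

end LoopClosure

namespace FourBar

variable (B : FourBar)

open LaurentPolynomial LoopClosure

theorem loopPoly_mul :
    B.loopPoly * (C (T 1) * T 1) = Polynomial.toLaurent (quad (-B.G1 : ℝ) B.G2 B.G3) := by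
  have hx : (C (T 1) * C (T (-1)) : ℂ[T;T⁻¹][T;T⁻¹]) = 1 := by rw [← map_mul, ← T_add]; simp
  have hy : (T 1 * T (-1) : ℂ[T;T⁻¹][T;T⁻¹]) = 1 := by rw [← T_add]; simp
  simp only [loopPoly, quad, coeffOne, coeffTwo, coeffZero, map_mul, map_add, map_sub, map_pow,
    Polynomial.toLaurent_C, Polynomial.toLaurent_X, Complex.ofReal_neg, map_neg, map_one]
  generalize (C (T 1) : ℂ[T;T⁻¹][T;T⁻¹]) = x at *
  generalize (C (T (-1)) : ℂ[T;T⁻¹][T;T⁻¹]) = x' at *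
  generalize (T 1 : ℂ[T;T⁻¹][T;T⁻¹]) = y at *
  generalize (T (-1) : ℂ[T;T⁻¹][T;T⁻¹]) = y' at *
  generalize (C (C (B.G1 : ℂ)) : ℂ[T;T⁻¹][T;T⁻¹]) = a
  generalize (C (C (B.G2 : ℂ)) : ℂ[T;T⁻¹][T;T⁻¹]) = b
  generalize (C (C (B.G3 : ℂ)) : ℂ[T;T⁻¹][T;T⁻¹]) = c
  linear_combination (a * x + b * y + c) * (a * y) * hx + (a * x + b * y + c) * (b * x) * hy

/-- In the special cases the closure polynomial has two factors that vanish at a common point. -/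
theorem not_irreducible_loopPoly (h : B.CaseII ∨ B.CaseIII ∨ B.CaseIV) :
    ¬ Irreducible B.loopPoly := by
  have h3 := B.l3_pos.ne'
  have hd := B.d_pos.ne'
  have hx : (C (T 1) * C (T (-1)) : ℂ[T;T⁻¹][T;T⁻¹]) = 1 := by rw [← map_mul, ← T_add]; simp
  have hy : (T 1 * T (-1) : ℂ[T;T⁻¹][T;T⁻¹]) = 1 := by rw [← T_add]; simp
  rcases h with ⟨h12, h3d⟩ | ⟨h1d, h23⟩ | ⟨h2d, h13⟩
  · have e1 : B.G1 = -B.G2 := by rw [G1, G2, h12]; ring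
    have e3 : B.G3 = 1 := by rw [G3, h3d]; field_simp
    refine not_irreducible_of_eq_mul 1 1
      (f := -C (C (B.G2 : ℂ)) * C (T (-1)) * T (-1) * (C (T 1) - T 1))
      (g := C (C (B.G2 : ℂ)) * (C (T 1) - T 1) + (C (T 1) * T 1 - 1)) ?_ (by simp) (by simp)
    rw [loopPoly, e1, e3]
    simp only [Complex.ofReal_neg, Complex.ofReal_one, map_neg, map_one]
    generalize (C (T 1) : ℂ[T;T⁻¹][T;T⁻¹]) = x at *
    generalize (C (T (-1)) : ℂ[T;T⁻¹][T;T⁻¹]) = x' at *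
    generalize (T 1 : ℂ[T;T⁻¹][T;T⁻¹]) = y at *
    generalize (T (-1) : ℂ[T;T⁻¹][T;T⁻¹]) = y' at *
    generalize (C (C (B.G2 : ℂ)) : ℂ[T;T⁻¹][T;T⁻¹]) = b
    linear_combination
      (b ^ 2 + b ^ 2 * x * y' - 2 * b ^ 2 * y * y' + b * x * y * y' - b * y' -
        b * y * y * y') * hx +
      (b ^ 2 - 2 * b ^ 2 + b ^ 2 * x' * y + b * x - b * y + b * x') * hy
  · have e1 : B.G1 = -B.G3 := by rw [G1, G3, h1d]; ring
    have e2 : B.G2 = 1 := by rw [G2, h23]; field_simp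
    refine not_irreducible_of_eq_mul 1 1
      (f := C (C (B.G3 : ℂ)) * C (T (-1)) * T (-1) * (C (T 1) - 1))
      (g := T 1 ^ 2 - C (C (B.G3 : ℂ)) * (C (T 1) - 1) * T 1 - C (T 1)) ?_ (by simp) (by simp)
    rw [loopPoly, e1, e2]
    simp only [Complex.ofReal_neg, Complex.ofReal_one, map_neg, map_one]
    generalize (C (T 1) : ℂ[T;T⁻¹][T;T⁻¹]) = x at *
    generalize (C (T (-1)) : ℂ[T;T⁻¹][T;T⁻¹]) = x' at *
    generalize (T 1 : ℂ[T;T⁻¹][T;T⁻¹]) = y at *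
    generalize (T (-1) : ℂ[T;T⁻¹][T;T⁻¹]) = y' at *
    generalize (C (C (B.G3 : ℂ)) : ℂ[T;T⁻¹][T;T⁻¹]) = b
    linear_combination
      (b ^ 2 - (b * y * y * y' - b ^ 2 * x * y * y' + 2 * b ^ 2 * y * y' - b * x * y' +
        b * y')) * hx +
      (1 - (b * y - b * x' * y - b ^ 2 * x + 2 * b ^ 2 - b ^ 2 * x')) * hy
  · have e1 : B.G1 = -1 := by rw [G1, h13]; field_simp
    have e2 : B.G2 = B.G3 := by rw [G2, G3, h2d]
    refine not_irreducible_of_eq_mul 1 (-1)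
      (f := C (C (B.G3 : ℂ)) * C (T (-1)) * T (-1) * (T 1 + 1))
      (g := C (C (B.G3 : ℂ)) * C (T 1) * (T 1 + 1) - (C (T 1) ^ 2 + T 1)) ?_ (by simp) (by simp)
    rw [loopPoly, e1, e2]
    simp only [Complex.ofReal_neg, Complex.ofReal_one, map_neg, map_one]
    generalize (C (T 1) : ℂ[T;T⁻¹][T;T⁻¹]) = x at *
    generalize (C (T (-1)) : ℂ[T;T⁻¹][T;T⁻¹]) = x' at *
    generalize (T 1 : ℂ[T;T⁻¹][T;T⁻¹]) = y at *
    generalize (T (-1) : ℂ[T;T⁻¹][T;T⁻¹]) = y' at *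
    generalize (C (C (B.G3 : ℂ)) : ℂ[T;T⁻¹][T;T⁻¹]) = b
    linear_combination
      (1 - (b ^ 2 * y * y * y' + 2 * b ^ 2 * y * y' + b ^ 2 * y' - b * x * y * y' -
        b * x * y')) * hx +
      (b ^ 2 - (b ^ 2 * y + 2 * b ^ 2 - b * x - b * x' * y - b * x')) * hy

theorem coeffs_pos : 0 < -B.G1 ∧ 0 < B.G2 ∧ 0 < B.G3 := by
  have a0 := B.l1_pos
  have b0 := B.l2_pos
  have c0 := B.l3_pos
  have d0 := B.d_pos
  refine ⟨?_, ?_, ?_⟩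
  · rw [G1, neg_div, neg_neg]; positivity
  · rw [G2]; positivity
  · rw [G3]; positivity

/-- The closure polynomial has zeros with both coordinates nonzero. -/
theorem not_isUnit_loopPoly : ¬ IsUnit B.loopPoly := by
  obtain ⟨hα, hβ, hγ⟩ := B.coeffs_pos
  -- For `z1 = I` the closure polynomial is quadratic in `z2` with nonzero constant coefficient.
  have hlead : (B.G2 * (B.G3 * Complex.I + B.G1) : ℂ) ≠ 0 := by
    intro h
    have := congrArg Complex.im h
    simp [hβ.ne', hγ.ne'] at this
  have hconst : (B.G2 * (B.G3 * Complex.I - B.G1) : ℂ) ≠ 0 := by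
    intro h
    have := congrArg Complex.im h
    simp [hβ.ne', hγ.ne'] at this
  obtain ⟨y, hy⟩ := IsAlgClosed.exists_root (Polynomial.C (B.G2 * (B.G3 * Complex.I + B.G1) : ℂ) *
    Polynomial.X ^ 2 + Polynomial.C ((B.G1 ^ 2 + B.G2 ^ 2 + B.G3 ^ 2 - 1) * Complex.I) *
    Polynomial.X + Polynomial.C (B.G2 * (B.G3 * Complex.I - B.G1) : ℂ))
    (by rw [Polynomial.degree_quadratic hlead]; simp)
  have hy0 : y ≠ 0 := by
    rintro rfl
    simp [Polynomial.IsRoot.def, -mul_eq_zero] at hy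
    exact hconst hy
  refine not_isUnit_of_evalAt_eq_zero (Units.mk0 Complex.I Complex.I_ne_zero) (Units.mk0 y hy0) ?_
  simp [Polynomial.IsRoot.def] at hy
  simp [loopPoly]
  field_simp
  linear_combination -Complex.I * hy + ((B.G2 ^ 2 + B.G3 ^ 2 - 1) * y +
    B.G2 * B.G3 * (y ^ 2 + 1)) * Complex.I_sq

theorem caseII_or_caseIV_of_eq (h1 : B.l1 + B.d = B.l2 + B.l3)
    (h2 : (B.l1 - B.d) ^ 2 = (B.l2 - B.l3) ^ 2) : B.CaseII ∨ B.CaseIV := by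
  rcases sq_eq_sq_iff_eq_or_eq_neg.1 h2 with h | h
  · exact Or.inl ⟨by linarith, by linarith⟩
  · exact Or.inr ⟨by linarith, by linarith⟩

/-- The range of `v = |l1 z1 - d| ^ 2` is bounded by `(l1 ± d) ^ 2` and by `(l2 ± l3) ^ 2`; the two
pairs of bounds agree only if `l1 + d = l2 + l3`, in one of two special cases. -/
theorem caseII_or_caseIV_of_sq_eq (h1 : (B.l1 + B.d) ^ 2 = (B.l2 + B.l3) ^ 2)
    (h2 : (B.l1 - B.d) ^ 2 = (B.l2 - B.l3) ^ 2) : B.CaseII ∨ B.CaseIV := by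
  have := B.l1_pos
  have := B.l2_pos
  have := B.l3_pos
  have := B.d_pos
  exact B.caseII_or_caseIV_of_eq ((sq_eq_sq₀ (by positivity) (by positivity)).1 h1) h2

/-- Multiplication by the unit `z1 z2` turns a factorization of the closure polynomial into one of
`LoopClosure.quad`. -/
theorem irreducible_loopPoly (h2 : ¬ B.CaseII) (h3 : ¬ B.CaseIII) (h4 : ¬ B.CaseIV) :
    Irreducible B.loopPoly := by
  refine ⟨B.not_isUnit_loopPoly, fun f g hfg => ?_⟩
  have a0 := B.l1_pos
  have b0 := B.l2_pos
  have c0 := B.l3_pos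
  have d0 := B.d_pos
  obtain ⟨hα, hβ, hγ⟩ := B.coeffs_pos
  have hu : IsUnit (C (T 1) * T 1 : ℂ[T;T⁻¹][T;T⁻¹]) :=
    ((isUnit_T (R := ℂ) 1).map C).mul (isUnit_T 1)
  have h : f * (g * (C (T 1) * T 1)) = Polynomial.toLaurent (quad (-B.G1 : ℝ) B.G2 B.G3) := by
    rw [← loopPoly_mul, hfg, mul_assoc]
  refine (isUnit_or_isUnit_of_mul_eq_toLaurent_quad ?_ ?_ ?_ ?_ ?_ ?_ h).imp_right
    isUnit_of_mul_isUnit_left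
  · exact_mod_cast hα.ne'
  · exact_mod_cast hβ.ne'
  · exact_mod_cast hγ.ne'
  · exact_mod_cast (add_pos hα hγ).ne'
  · rintro ⟨e1, e2⟩
    have e1' : -B.G1 = B.G3 := by exact_mod_cast e1
    have e2' : B.G2 ^ 2 = 1 := by exact_mod_cast e2
    have e3 : B.G2 = 1 := by
      nlinarith
    rw [G1, G3] at e1'
    rw [G2] at e3
    field_simp at e1' e3
    exact h3 ⟨by linarith, by linarith⟩
  · rintro ⟨e1, e2⟩
    have e1' : ((-B.G1 + B.G3) ^ 2 - (B.G2 + 1) ^ 2) *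
        ((-B.G1 - B.G3) ^ 2 - (B.G2 + 1) ^ 2) = 0 := by
      exact_mod_cast e1
    have e2' : ((-B.G1 + B.G3) ^ 2 - (B.G2 - 1) ^ 2) *
        ((-B.G1 - B.G3) ^ 2 - (B.G2 - 1) ^ 2) = 0 := by
      exact_mod_cast e2
    have hαγ := mul_pos hα hγ
    obtain ⟨k1, k2⟩ : (-B.G1 + B.G3) ^ 2 = (B.G2 + 1) ^ 2 ∧
        (-B.G1 - B.G3) ^ 2 = (B.G2 - 1) ^ 2 := by
      rcases mul_eq_zero.1 e1' with h | h <;> rcases mul_eq_zero.1 e2' with h' | h'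
      · exact absurd h' (by linarith)
      · exact ⟨sub_eq_zero.1 h, sub_eq_zero.1 h'⟩
      · exact absurd h' (by linarith)
      · exact absurd h' (by linarith)
    rw [G1, G2, G3] at k1 k2
    field_simp at k1 k2
    exact (B.caseII_or_caseIV_of_sq_eq (by linarith) (by linarith)).elim h2 h4

theorem irreducible_loopPoly_iff :
    Irreducible B.loopPoly ↔ ¬ B.CaseII ∧ ¬ B.CaseIII ∧ ¬ B.CaseIV := by
  refine ⟨fun h => ?_, fun h => B.irreducible_loopPoly h.1 h.2.1 h.2.2⟩
  have := mt B.not_irreducible_loopPoly (not_not.2 h)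
  tauto

end FourBar

/-! ### Configurations and static balancing -/

namespace FourBar

variable (B : FourBar)

variable {B} in
/-- The closure equation as a quadratic equation for `z2` over `z1`. -/
theorem quadratic_of_mem_configs {z : ℂ × ℂ} (hz : z ∈ B.configs) :
    (B.l2 * (B.d * z.1 - B.l1) : ℂ) * z.2 ^ 2 +
      ((B.l1 ^ 2 + B.l2 ^ 2 + B.d ^ 2 - B.l3 ^ 2) * z.1 - B.l1 * B.d * (z.1 ^ 2 + 1)) * z.2 +
      B.l2 * z.1 * (B.d - B.l1 * z.1) = 0 := by
  obtain ⟨h1, h2, h3⟩ := hz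
  have hx : z.1 ≠ 0 := fun h => by simp [h] at h1
  have hy : z.2 ≠ 0 := fun h => by simp [h] at h2
  have hc : (B.l3 : ℂ) ≠ 0 := by exact_mod_cast B.l3_pos.ne'
  simp only [G, G1, G2, G3] at h3
  push_cast at h3
  field_simp at h3
  linear_combination h3

variable {B} in
theorem norm_z3_of_mem_configs {z : ℂ × ℂ} (hz : z ∈ B.configs) : ‖B.z3 z‖ = 1 := by
  obtain ⟨h1, h2, h3⟩ := hz
  have hx := Complex.inv_eq_conj h1
  have hy := Complex.inv_eq_conj h2
  have h : starRingEnd ℂ (B.z3 z) = B.G1 * z.1⁻¹ + B.G2 * z.2⁻¹ + B.G3 := by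
    rw [hx, hy, z3]; simp
  have h4 : B.z3 z * starRingEnd ℂ (B.z3 z) = 1 := by
    rw [h, z3]; exact sub_eq_zero.1 h3
  rw [Complex.mul_conj, Complex.normSq_eq_norm_sq] at h4
  have h5 : ‖B.z3 z‖ ^ 2 = 1 := by exact_mod_cast h4
  exact (pow_eq_one_iff_of_nonneg (norm_nonneg _) two_ne_zero).1 h5

variable {B} {S : Set (ℂ × ℂ)}

theorem ofReal_lengths_ne_zero (B : FourBar) :
    (B.l1 : ℂ) ≠ 0 ∧ (B.l2 : ℂ) ≠ 0 ∧ (B.l3 : ℂ) ≠ 0 ∧ (B.d : ℂ) ≠ 0 := by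
  refine ⟨?_, ?_, ?_, ?_⟩ <;> norm_cast
  exacts [B.l1_pos.ne', B.l2_pos.ne', B.l3_pos.ne', B.d_pos.ne']

/-- The first link can rest while the others move only in the deltoid mode `z1 = 1`. -/
theorem caseIII_of_fst_eq (hS : S ⊆ B.configs) (hS' : S.Infinite) {k : ℂ}
    (h : ∀ z ∈ S, z.1 = k) : B.CaseIII ∧ k = 1 := by
  obtain ⟨ha, hb, hc, hd⟩ := B.ofReal_lengths_ne_zero
  have hT : (Prod.snd '' S).Infinite := hS'.image fun z hz w hw hzw =>
    Prod.ext ((h z hz).trans (h w hw).symm) hzw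
  obtain ⟨h0, h1, h2⟩ := quadratic_coeffs_eq_zero hT (a := B.l2 * k * (B.d - B.l1 * k))
    (b := (B.l1 ^ 2 + B.l2 ^ 2 + B.d ^ 2 - B.l3 ^ 2) * k - B.l1 * B.d * (k ^ 2 + 1))
    (c := B.l2 * (B.d * k - B.l1)) (by
      rintro _ ⟨z, hz, rfl⟩
      have := quadratic_of_mem_configs (hS hz)
      rw [h z hz] at this
      linear_combination this)
  have h2' : B.d * k = B.l1 := sub_eq_zero.1 ((mul_eq_zero.1 h2).resolve_left hb)
  have hk : k ≠ 0 := by rintro rfl; exact ha (by rw [← h2', mul_zero])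
  have h0' : (B.d : ℂ) = B.l1 * k :=
    sub_eq_zero.1 ((mul_eq_zero.1 h0).resolve_left (mul_ne_zero hb hk))
  have h3 : (B.l1 : ℂ) ^ 2 = B.d ^ 2 :=
    mul_right_cancel₀ hk (by linear_combination -B.l1 * h0' - B.d * h2')
  have h4 : B.l1 = B.d := by
    have h3' : B.l1 ^ 2 = B.d ^ 2 := by exact_mod_cast h3
    exact (sq_eq_sq₀ B.l1_pos.le B.d_pos.le).1 h3'
  have hk1 : k = 1 := by
    rw [h4] at h2'
    exact mul_left_cancel₀ hd (by rw [h2', mul_one])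
  subst hk1
  rw [h4] at h1
  refine ⟨⟨h4, ?_⟩, rfl⟩
  have h5 : (B.l2 : ℂ) ^ 2 = B.l3 ^ 2 := by linear_combination h1
  have h5' : B.l2 ^ 2 = B.l3 ^ 2 := by exact_mod_cast h5
  exact (sq_eq_sq₀ B.l2_pos.le B.l3_pos.le).1 h5'

/-- The second link can rest while the others move only in the deltoid mode `z2 = -1`. -/
theorem caseIV_of_snd_eq (hS : S ⊆ B.configs) (hS' : S.Infinite) {k : ℂ}
    (h : ∀ z ∈ S, z.2 = k) : B.CaseIV ∧ k = -1 := by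
  obtain ⟨ha, hb, hc, hd⟩ := B.ofReal_lengths_ne_zero
  have hT : (Prod.fst '' S).Infinite := hS'.image fun z hz w hw hzw =>
    Prod.ext hzw ((h z hz).trans (h w hw).symm)
  obtain ⟨h0, h1, h2⟩ := quadratic_coeffs_eq_zero hT (a := -B.l1 * k * (B.l2 * k + B.d))
    (b := (B.l1 ^ 2 + B.l2 ^ 2 + B.d ^ 2 - B.l3 ^ 2) * k + B.l2 * B.d * (k ^ 2 + 1))
    (c := -B.l1 * (B.d * k + B.l2)) (by
      rintro _ ⟨z, hz, rfl⟩
      have := quadratic_of_mem_configs (hS hz)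
      rw [h z hz] at this
      linear_combination this)
  have h2' : B.d * k = -B.l2 :=
    eq_neg_of_add_eq_zero_left ((mul_eq_zero.1 h2).resolve_left (neg_ne_zero.2 ha))
  have hk : k ≠ 0 := by rintro rfl; exact hb (by linear_combination h2')
  have h0' : B.l2 * k = -B.d :=
    eq_neg_of_add_eq_zero_left
      ((mul_eq_zero.1 h0).resolve_left (mul_ne_zero (neg_ne_zero.2 ha) hk))
  have h3 : (B.l2 : ℂ) ^ 2 = B.d ^ 2 :=
    mul_right_cancel₀ hk (by linear_combination B.l2 * h0' - B.d * h2')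
  have h4 : B.l2 = B.d := by
    have h3' : B.l2 ^ 2 = B.d ^ 2 := by exact_mod_cast h3
    exact (sq_eq_sq₀ B.l2_pos.le B.d_pos.le).1 h3'
  have hk1 : k = -1 := by
    rw [h4] at h2'
    exact mul_left_cancel₀ hd (by rw [h2', mul_neg_one])
  subst hk1
  rw [h4] at h1
  refine ⟨⟨h4, ?_⟩, rfl⟩
  have h5 : (B.l1 : ℂ) ^ 2 = B.l3 ^ 2 := by linear_combination -h1
  have h5' : B.l1 ^ 2 = B.l3 ^ 2 := by exact_mod_cast h5
  exact (sq_eq_sq₀ B.l1_pos.le B.l3_pos.le).1 h5'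

/-- The links at the base can keep their relative direction only in the parallelogram mode. -/
theorem caseII_of_snd_eq_mul_fst (hS : S ⊆ B.configs) (hS' : S.Infinite) {k : ℂ}
    (h : ∀ z ∈ S, z.2 = k * z.1) : B.CaseII ∧ k = 1 := by
  obtain ⟨ha, hb, hc, hd⟩ := B.ofReal_lengths_ne_zero
  have hT : (Prod.fst '' S).Infinite := hS'.image fun z hz w hw hzw =>
    Prod.ext hzw (by rw [h z hz, h w hw]; exact congrArg _ hzw)
  obtain ⟨h0, h1, h2⟩ := quadratic_coeffs_eq_zero hT (a := B.d * (B.l2 - B.l1 * k))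
    (b := (B.l1 ^ 2 + B.l2 ^ 2 + B.d ^ 2 - B.l3 ^ 2) * k - B.l1 * B.l2 * (k ^ 2 + 1))
    (c := B.d * k * (B.l2 * k - B.l1)) (by
      rintro _ ⟨z, hz, rfl⟩
      have hx : z.1 ≠ 0 := fun h => by have := (hS hz).1; simp [h] at this
      have := quadratic_of_mem_configs (hS hz)
      rw [h z hz] at this
      refine mul_left_cancel₀ hx ?_
      linear_combination this)
  have h0' : (B.l2 : ℂ) = B.l1 * k := sub_eq_zero.1 ((mul_eq_zero.1 h0).resolve_left hd)
  have hk : k ≠ 0 := by rintro rfl; exact hb (by rw [h0', mul_zero])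
  have h2' : B.l2 * k = B.l1 :=
    sub_eq_zero.1 ((mul_eq_zero.1 h2).resolve_left (mul_ne_zero hd hk))
  have h3 : (B.l1 : ℂ) ^ 2 = B.l2 ^ 2 :=
    mul_right_cancel₀ hk (by linear_combination -B.l1 * h0' - B.l2 * h2')
  have h4 : B.l1 = B.l2 := by
    have h3' : B.l1 ^ 2 = B.l2 ^ 2 := by exact_mod_cast h3
    exact (sq_eq_sq₀ B.l1_pos.le B.l2_pos.le).1 h3'
  have hk1 : k = 1 := by
    rw [h4] at h2'
    exact mul_left_cancel₀ hb (by rw [h2', mul_one])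
  subst hk1
  rw [h4] at h1
  refine ⟨⟨h4, ?_⟩, rfl⟩
  have h5 : (B.l3 : ℂ) ^ 2 = B.d ^ 2 := by linear_combination -h1
  have h5' : B.l3 ^ 2 = B.d ^ 2 := by exact_mod_cast h5
  exact (sq_eq_sq₀ B.l3_pos.le B.d_pos.le).1 h5'

theorem staticallyBalancedOn_iff :
    B.StaticallyBalancedOn S ↔ ∃ c, ∀ z ∈ S, B.F1 * z.1 + B.F2 * z.2 = c := by
  have hM : (B.m1 + B.m2 + B.m3 : ℂ) ≠ 0 := by
    have := add_pos (add_pos B.m1_pos B.m2_pos) B.m3_pos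
    exact_mod_cast this.ne'
  have key : ∀ z, B.centreOfMass z = (B.F1 * z.1 + B.F2 * z.2 +
      (B.m2 * B.d + B.m3 * B.r3 * B.p3 * B.G3)) / (B.m1 + B.m2 + B.m3) := by
    intro z
    simp only [centreOfMass, pos1, pos2, pos3, z3, F1, F2]
    congr 1
    ring
  simp only [StaticallyBalancedOn, key]
  constructor
  · rintro ⟨c, h⟩
    refine ⟨c * (B.m1 + B.m2 + B.m3) - (B.m2 * B.d + B.m3 * B.r3 * B.p3 * B.G3), fun z hz => ?_⟩
    rw [← h z hz, div_mul_cancel₀ _ hM]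
    ring
  · rintro ⟨c, h⟩
    exact ⟨(c + (B.m2 * B.d + B.m3 * B.r3 * B.p3 * B.G3)) / (B.m1 + B.m2 + B.m3),
      fun z hz => by rw [h z hz]⟩

theorem StaticallyBalancedOn.of_F_eq_zero (h : B.F1 = 0 ∧ B.F2 = 0) :
    B.StaticallyBalancedOn S :=
  staticallyBalancedOn_iff.2 ⟨0, fun z _ => by simp [h.1, h.2]⟩

/-- A line `F1 z1 + F2 z2 = c` meets the unit torus in infinitely many points only if it is one of
`z1 = k`, `z2 = k`, `z2 = k z1`; on the configuration curve this singles out the special modes. -/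
theorem StaticallyBalancedOn.cases (hS : S ⊆ B.configs) (hS' : S.Infinite)
    (h : B.StaticallyBalancedOn S) :
    (B.F1 = 0 ∧ B.F2 = 0) ∨
    (B.CaseII ∧ B.F1 + B.F2 = 0 ∧ ∀ z ∈ S, z.1 = z.2) ∨
    (B.CaseIII ∧ B.F2 = 0 ∧ ∀ z ∈ S, z.1 = 1) ∨
    (B.CaseIV ∧ B.F1 = 0 ∧ ∀ z ∈ S, z.2 = -1) := by
  obtain ⟨c, hc⟩ := staticallyBalancedOn_iff.1 h
  by_cases h1 : B.F1 = 0
  · by_cases h2 : B.F2 = 0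
    · exact Or.inl ⟨h1, h2⟩
    · have hy : ∀ z ∈ S, z.2 = c / B.F2 := fun z hz => by
        rw [eq_div_iff h2, ← hc z hz, h1]; ring
      obtain ⟨h3, h4⟩ := caseIV_of_snd_eq hS hS' hy
      exact Or.inr (Or.inr (Or.inr ⟨h3, h1, fun z hz => (hy z hz).trans h4⟩))
  by_cases h2 : B.F2 = 0
  · have hx : ∀ z ∈ S, z.1 = c / B.F1 := fun z hz => by
      rw [eq_div_iff h1, ← hc z hz, h2]; ring
    obtain ⟨h3, h4⟩ := caseIII_of_fst_eq hS hS' hx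
    exact Or.inr (Or.inr (Or.inl ⟨h3, h2, fun z hz => (hx z hz).trans h4⟩))
  have hT : (Prod.fst '' S).Infinite := hS'.image fun z hz w hw hzw => by
    refine Prod.ext hzw (mul_left_cancel₀ h2 ?_)
    have hzw' : z.1 = w.1 := hzw
    linear_combination hc z hz - hc w hw - B.F1 * hzw'
  -- Eliminate `z2` between the equation of the line and its complex conjugate.
  obtain ⟨h3, -, -⟩ := quadratic_coeffs_eq_zero hT (a := starRingEnd ℂ B.F1 * c)
    (b := starRingEnd ℂ B.F2 * B.F2 - starRingEnd ℂ B.F1 * B.F1 - starRingEnd ℂ c * c)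
    (c := starRingEnd ℂ c * B.F1) (by
      rintro _ ⟨z, hz, rfl⟩
      have e := hc z hz
      have e' := congrArg (starRingEnd ℂ) e
      simp only [map_add, map_mul] at e'
      have ex := Complex.conj_mul_of_norm_one (hS hz).1
      have ey := Complex.conj_mul_of_norm_one (hS hz).2.1
      linear_combination B.F2 * z.1 * z.2 * e' - B.F2 * z.2 * starRingEnd ℂ B.F1 * ex -
        B.F2 * z.1 * starRingEnd ℂ B.F2 * ey -
        (starRingEnd ℂ B.F1 - starRingEnd ℂ c * z.1) * e)
  have hc0 : c = 0 := (mul_eq_zero.1 h3).resolve_left ((map_ne_zero _).2 h1)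
  subst hc0
  have hxy : ∀ z ∈ S, z.2 = -B.F1 / B.F2 * z.1 := fun z hz => by
    field_simp
    linear_combination hc z hz
  obtain ⟨h4, h5⟩ := caseII_of_snd_eq_mul_fst hS hS' hxy
  refine Or.inr (Or.inl ⟨h4, ?_, fun z hz => ?_⟩)
  · rw [div_eq_one_iff_eq h2] at h5
    linear_combination -h5
  · rw [hxy z hz, h5, one_mul]

theorem staticallyBalancedOn_iff_of_fst_eq_snd (hS : S ⊆ B.configs) (hS' : S.Infinite)
    (h : ∀ z ∈ S, z.1 = z.2) : B.StaticallyBalancedOn S ↔ B.F1 + B.F2 = 0 := by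
  constructor
  · intro hB
    rcases hB.cases hS hS' with h1 | h1 | h1 | h1
    · rw [h1.1, h1.2, add_zero]
    · exact h1.2.1
    all_goals
      obtain ⟨z, hz, w, hw, hzw⟩ := hS'.nontrivial
      have e1 := h z hz
      have e2 := h w hw
      have e3 := h1.2.2 z hz
      have e4 := h1.2.2 w hw
      refine absurd (Prod.ext ?_ ?_) hzw <;> simp_all
  · intro h1
    exact staticallyBalancedOn_iff.2 ⟨0, fun z hz => by rw [h z hz]; linear_combination z.2 * h1⟩

theorem staticallyBalancedOn_iff_of_fst_eq_one (hS : S ⊆ B.configs) (hS' : S.Infinite)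
    (h : ∀ z ∈ S, z.1 = 1) : B.StaticallyBalancedOn S ↔ B.F2 = 0 := by
  constructor
  · intro hB
    rcases hB.cases hS hS' with h1 | h1 | h1 | h1
    · exact h1.2
    · exfalso
      obtain ⟨z, hz, w, hw, hzw⟩ := hS'.nontrivial
      exact hzw (Prod.ext (by rw [h z hz, h w hw])
        (by rw [← h1.2.2 z hz, ← h1.2.2 w hw, h z hz, h w hw]))
    · exact h1.2.1
    · exfalso
      obtain ⟨z, hz, w, hw, hzw⟩ := hS'.nontrivial
      exact hzw (Prod.ext (by rw [h z hz, h w hw]) (by rw [h1.2.2 z hz, h1.2.2 w hw]))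
  · intro h1
    exact staticallyBalancedOn_iff.2 ⟨B.F1, fun z hz => by rw [h z hz, h1]; ring⟩

theorem staticallyBalancedOn_iff_of_snd_eq_neg_one (hS : S ⊆ B.configs) (hS' : S.Infinite)
    (h : ∀ z ∈ S, z.2 = -1) : B.StaticallyBalancedOn S ↔ B.F1 = 0 := by
  constructor
  · intro hB
    rcases hB.cases hS hS' with h1 | h1 | h1 | h1
    · exact h1.1
    · exfalso
      obtain ⟨z, hz, w, hw, hzw⟩ := hS'.nontrivial
      exact hzw (Prod.ext (by rw [h1.2.2 z hz, h1.2.2 w hw, h z hz, h w hw])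
        (by rw [h z hz, h w hw]))
    · exfalso
      obtain ⟨z, hz, w, hw, hzw⟩ := hS'.nontrivial
      exact hzw (Prod.ext (by rw [h1.2.2 z hz, h1.2.2 w hw]) (by rw [h z hz, h w hw]))
    · exact h1.2.1
  · intro h1
    exact staticallyBalancedOn_iff.2 ⟨-B.F2, fun z hz => by rw [h z hz, h1]; ring⟩

/-- Away from the special modes, static balancing means `F1 = F2 = 0`. -/
theorem staticallyBalancedOn_iff_F_eq_zero (hS : S ⊆ B.configs) (hS' : S.Infinite)
    (h2 : ¬ (B.CaseII ∧ ∀ z ∈ S, z.1 = z.2)) (h3 : ¬ (B.CaseIII ∧ ∀ z ∈ S, z.1 = 1))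
    (h4 : ¬ (B.CaseIV ∧ ∀ z ∈ S, z.2 = -1)) :
    B.StaticallyBalancedOn S ↔ B.F1 = 0 ∧ B.F2 = 0 := by
  refine ⟨fun h => ?_, StaticallyBalancedOn.of_F_eq_zero⟩
  rcases h.cases hS hS' with h | h | h | h
  · exact h
  · exact absurd ⟨h.1, h.2.2⟩ h2
  · exact absurd ⟨h.1, h.2.2⟩ h3
  · exact absurd ⟨h.1, h.2.2⟩ h4

end FourBar

/-! ### Angular momentum -/

namespace FourBar

variable {B : FourBar} {S : Set (ℂ × ℂ)}

theorem J1_pos (B : FourBar) : 0 < B.J1 :=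
  add_pos_of_pos_of_nonneg B.I1_pos (mul_nonneg B.m1_pos.le (sq_nonneg _))

theorem J2_pos (B : FourBar) : 0 < B.J2 :=
  add_pos_of_pos_of_nonneg B.I2_pos (mul_nonneg B.m2_pos.le (sq_nonneg _))

theorem J3_pos (B : FourBar) : 0 < B.J3 :=
  add_pos_of_pos_of_nonneg B.I3_pos (mul_nonneg B.m3_pos.le (sq_nonneg _))

theorem F1_eq (B : FourBar) : B.F1 = B.q1 + B.m3 * B.l1 + B.G1 * B.q3 := by
  simp only [F1, q1, q3]; ring

theorem F2_eq (B : FourBar) : B.F2 = B.q2 + B.G2 * B.q3 := by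
  simp only [F2, q2, q3]; ring

theorem inner_neg_I_mul_I_mul (u v : ℂ) :
    inner ℝ u (-Complex.I * (Complex.I * v)) = (starRingEnd ℂ u * v).re := by
  rw [Complex.inner, show -Complex.I * (Complex.I * v) = v by
    linear_combination -v * Complex.I_sq, mul_comm]

/-- The angular momentum in terms of the parameters `q2`, `q3` and `J1`, `J2`, `J3`. -/
theorem angularMomentum_eq {z : ℂ × ℂ} (hz : z ∈ B.configs) (ω1 ω2 ω3 : ℝ) :
    B.angularMomentum z ω1 ω2 ω3 = (B.J1 + B.m3 * B.l1 ^ 2) * ω1 + B.J2 * ω2 + B.J3 * ω3 +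
      B.d * (B.q2 * z.2).re * ω2 +
      B.l1 * (B.q3 * B.z3 z * starRingEnd ℂ z.1).re * (ω1 + ω3) := by
  have hx := Complex.conj_mul_of_norm_one hz.1
  have hy := Complex.conj_mul_of_norm_one hz.2.1
  have hw := Complex.conj_mul_of_norm_one (norm_z3_of_mem_configs hz)
  have h1 := Complex.conj_mul_of_norm_one B.norm_p1
  have h2 := Complex.conj_mul_of_norm_one B.norm_p2
  have h3 := Complex.conj_mul_of_norm_one B.norm_p3
  have e1 : (starRingEnd ℂ (B.pos1 z) * (B.r1 * B.p1 * z.1 * ω1)).re = B.r1 ^ 2 * ω1 := by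
    rw [pos1, show starRingEnd ℂ (B.r1 * B.p1 * z.1) * (B.r1 * B.p1 * z.1 * ω1) =
      ((B.r1 ^ 2 * ω1 : ℝ) : ℂ) by
        simp only [map_mul, Complex.conj_ofReal]; push_cast
        linear_combination (B.r1 ^ 2 * ω1 : ℂ) * h1 +
          (B.r1 ^ 2 * ω1 * (starRingEnd ℂ B.p1 * B.p1) : ℂ) * hx, Complex.ofReal_re]
  have e2 : (starRingEnd ℂ (B.pos2 z) * (B.r2 * B.p2 * z.2 * ω2)).re =
      B.r2 ^ 2 * ω2 + B.d * B.r2 * (B.p2 * z.2).re * ω2 := by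
    rw [pos2, show starRingEnd ℂ (B.d + B.r2 * B.p2 * z.2) * (B.r2 * B.p2 * z.2 * ω2) =
      ((B.r2 ^ 2 * ω2 : ℝ) : ℂ) + ((B.d * B.r2 * ω2 : ℝ) : ℂ) * (B.p2 * z.2) by
        simp only [map_mul, map_add, Complex.conj_ofReal]; push_cast
        linear_combination (B.r2 ^ 2 * ω2 : ℂ) * h2 +
          (B.r2 ^ 2 * ω2 * (starRingEnd ℂ B.p2 * B.p2) : ℂ) * hy, Complex.add_re,
      Complex.ofReal_re, Complex.re_ofReal_mul]
    ring
  have e3 : (starRingEnd ℂ (B.pos3 z) *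
      (B.l1 * z.1 * ω1 + B.r3 * B.p3 * B.z3 z * ω3)).re =
      B.l1 ^ 2 * ω1 + B.r3 ^ 2 * ω3 +
        B.l1 * B.r3 * (B.p3 * B.z3 z * starRingEnd ℂ z.1).re * (ω1 + ω3) := by
    rw [pos3, show starRingEnd ℂ (B.l1 * z.1 + B.r3 * B.p3 * B.z3 z) *
      (B.l1 * z.1 * ω1 + B.r3 * B.p3 * B.z3 z * ω3) =
      ((B.l1 ^ 2 * ω1 + B.r3 ^ 2 * ω3 : ℝ) : ℂ) +
      ((B.l1 * B.r3 * ω3 : ℝ) : ℂ) * (B.p3 * B.z3 z * starRingEnd ℂ z.1) +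
      ((B.l1 * B.r3 * ω1 : ℝ) : ℂ) * starRingEnd ℂ (B.p3 * B.z3 z * starRingEnd ℂ z.1) by
        simp only [map_mul, map_add, Complex.conj_ofReal, Complex.conj_conj]; push_cast
        linear_combination (B.l1 ^ 2 * ω1 : ℂ) * hx + (B.r3 ^ 2 * ω3 : ℂ) * h3 +
          (B.r3 ^ 2 * ω3 * (starRingEnd ℂ B.p3 * B.p3) : ℂ) * hw, Complex.add_re, Complex.add_re,
      Complex.ofReal_re, Complex.re_ofReal_mul, Complex.re_ofReal_mul, Complex.conj_re]
    ring
  have e4 : (B.q2 * z.2).re = B.m2 * B.r2 * (B.p2 * z.2).re := by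
    rw [q2, show (B.m2 * B.r2 * B.p2 * z.2 : ℂ) = ((B.m2 * B.r2 : ℝ) : ℂ) * (B.p2 * z.2) by
      push_cast; ring, Complex.re_ofReal_mul]
  have e5 : (B.q3 * B.z3 z * starRingEnd ℂ z.1).re =
      B.m3 * B.r3 * (B.p3 * B.z3 z * starRingEnd ℂ z.1).re := by
    rw [q3, show (B.m3 * B.r3 * B.p3 * B.z3 z * starRingEnd ℂ z.1 : ℂ) =
      ((B.m3 * B.r3 : ℝ) : ℂ) * (B.p3 * B.z3 z * starRingEnd ℂ z.1) by
      push_cast; ring, Complex.re_ofReal_mul]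
  rw [angularMomentum, vel1, vel2, vel3, inner_neg_I_mul_I_mul, inner_neg_I_mul_I_mul,
    inner_neg_I_mul_I_mul, e1, e2, e3, e4, e5, J1, J2, J3]
  ring

/-- `(ω1, ω2, ω3)` with `ω1 = b (a s - d sin β)`, `ω2 = a (b s - d sin α)`, `ω3 = a b s`, where
`s = sin (β - α)`, is a velocity: these are the pairwise cross products of the three links. -/
theorem isVelocity_cross (B : FourBar) (z : ℂ × ℂ) :
    B.IsVelocity z
      (B.l2 * (B.l1 * (z.2.im * z.1.re - z.2.re * z.1.im) - B.d * z.2.im))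
      (B.l1 * (B.l2 * (z.2.im * z.1.re - z.2.re * z.1.im) - B.d * z.1.im))
      (B.l1 * B.l2 * (z.2.im * z.1.re - z.2.re * z.1.im)) := by
  have hc := B.l3_pos.ne'
  rw [IsVelocity, z3, G1, G2, G3]
  apply Complex.ext
  · simp [-Complex.ofReal_div, -Complex.ofReal_neg, -Complex.ofReal_mul, -Complex.ofReal_sub]
    field_simp
    ring
  · simp [-Complex.ofReal_div, -Complex.ofReal_neg, -Complex.ofReal_mul, -Complex.ofReal_sub]
    field_simp
    ring

theorem l3_mul_z3_re (B : FourBar) (z : ℂ × ℂ) :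
    B.l3 * (B.z3 z).re = -B.l1 * z.1.re + B.l2 * z.2.re + B.d := by
  have hc := B.l3_pos.ne'
  simp only [z3, G1, G2, G3, Complex.add_re, Complex.re_ofReal_mul, Complex.ofReal_re]
  field_simp

theorem l3_mul_z3_im (B : FourBar) (z : ℂ × ℂ) :
    B.l3 * (B.z3 z).im = -B.l1 * z.1.im + B.l2 * z.2.im := by
  have hc := B.l3_pos.ne'
  simp only [z3, G1, G2, G3, Complex.add_im, Complex.im_ofReal_mul, Complex.ofReal_im]
  field_simp
  ring

theorem closure_re_im {z : ℂ × ℂ} (hz : z ∈ B.configs) :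
    (B.d - B.l1 * z.1.re + B.l2 * z.2.re) ^ 2 + (B.l2 * z.2.im - B.l1 * z.1.im) ^ 2 =
      B.l3 ^ 2 := by
  linear_combination (B.l3 ^ 2) * Complex.sq_add_sq_of_norm_one (norm_z3_of_mem_configs hz) -
    (B.l3 * (B.z3 z).re + (-B.l1 * z.1.re + B.l2 * z.2.re + B.d)) * B.l3_mul_z3_re z -
    (B.l3 * (B.z3 z).im + (-B.l1 * z.1.im + B.l2 * z.2.im)) * B.l3_mul_z3_im z

end FourBar

/-! ### The general mechanism is not dynamically balanced -/

/-- The angular momentum, for the velocity of `FourBar.isVelocity_cross` and with the conditions of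
static balance inserted, is a combination of `1, σ, τ, σ τ` over the polynomials in
`v = |l1 z1 - d| ^ 2`, the square of a diagonal of the four-bar. Here `σ` and `τ` are four times the
signed areas of the two triangles into which this diagonal divides the four-bar, and the first two
conclusions are Heron's formula. -/
theorem angularMomentum_expansion {a b c d x1 x2 y1 y2 q p A1 J2 J3 v σ τ ω1 ω2 ω3 : ℝ}
    (hx : x1 ^ 2 + x2 ^ 2 = 1) (hy : y1 ^ 2 + y2 ^ 2 = 1)
    (hc : (d - a * x1 + b * y1) ^ 2 + (b * y2 - a * x2) ^ 2 = c ^ 2)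
    (hv : v = a ^ 2 + d ^ 2 - 2 * a * d * x1) (hσ : σ = 2 * a * d * x2)
    (hτ : τ = 2 * b * ((d - a * x1) * y2 + a * x2 * y1))
    (h1 : ω1 = b * (a * (y2 * x1 - y1 * x2) - d * y2))
    (h2 : ω2 = a * (b * (y2 * x1 - y1 * x2) - d * x2))
    (h3 : ω3 = a * b * (y2 * x1 - y1 * x2))
    (hL : c * (A1 * ω1 + J2 * ω2 + J3 * ω3) - b * d * (q * y1 - p * y2) * ω2 +
      a * (q * (-a + b * (x1 * y1 + x2 * y2) + d * x1) -
        p * (b * (y2 * x1 - y1 * x2) - d * x2)) * (ω1 + ω3) = 0) :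
    σ ^ 2 = -((v - (a + d) ^ 2) * (v - (a - d) ^ 2)) ∧
    τ ^ 2 = -((v - (b + c) ^ 2) * (v - (b - c) ^ 2)) ∧
    2 * p * (d ^ 2 - a ^ 2 - v) * (-((v - (b + c) ^ 2) * (v - (b - c) ^ 2))) +
      (2 * (c * (J3 - J2) - q * (b ^ 2 + c ^ 2)) * v +
        2 * (c ^ 2 - b ^ 2) * (q * (c ^ 2 - b ^ 2) - c * (J2 + J3))) * σ +
      (-4 * (c * A1 + q * ((a ^ 2 + b ^ 2 + d ^ 2 - c ^ 2) / 2 - 2 * a ^ 2)) * v -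
        q * (d ^ 2 - a ^ 2 + v) * (c ^ 2 - b ^ 2 - v) +
        2 * (c * (J2 + J3) + q / 2 * (v - (c ^ 2 - b ^ 2))) * (d ^ 2 - a ^ 2 - v)) * τ +
      -2 * p * (v + (c ^ 2 - b ^ 2)) * (σ * τ) = 0 := by
  -- The diagonal is the vector `(d - a x1, -a x2)`.
  have hv' : v = (d - a * x1) ^ 2 + (a * x2) ^ 2 := by
    rw [hv]; linear_combination -a ^ 2 * hx
  have hh : 2 * b * ((d - a * x1) * y1 - a * x2 * y2) = c ^ 2 - b ^ 2 - v := by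
    rw [hv']; linear_combination hc - b ^ 2 * hy
  have hτ2 : τ ^ 2 = -((v - (b + c) ^ 2) * (v - (b - c) ^ 2)) := by
    have e : τ ^ 2 = 4 * b ^ 2 * v - (c ^ 2 - b ^ 2 - v) ^ 2 := by
      rw [← hh, hτ]
      linear_combination 4 * b ^ 2 * ((d - a * x1) ^ 2 + (a * x2) ^ 2) * hy - 4 * b ^ 2 * hv'
    rw [e]; ring
  have hx1 : 2 * a * d * x1 = a ^ 2 + d ^ 2 - v := by linarith
  have e1 : ω1 = -τ / 2 := by rw [h1, hτ]; ring
  have ey1 : 4 * v * (b * d * y1) = (d ^ 2 - a ^ 2 + v) * (c ^ 2 - b ^ 2 - v) + σ * τ := by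
    linear_combination 4 * b * d * y1 * hv' + 2 * d * (d - a * x1) * hh -
      (c ^ 2 - b ^ 2 - v) * hv - τ * hσ - 2 * a * d * x2 * hτ
  have ey2 : 4 * v * (b * d * y2) = -σ * (c ^ 2 - b ^ 2 - v) + (d ^ 2 - a ^ 2 + v) * τ := by
    linear_combination 4 * b * d * y2 * hv' - 2 * a * d * x2 * hh +
      (c ^ 2 - b ^ 2 - v) * hσ - τ * hv - 2 * d * (d - a * x1) * hτ
  have e3 : 4 * v * ω3 = σ * (v - (c ^ 2 - b ^ 2)) + τ * (d ^ 2 - a ^ 2 - v) := by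
    have : ω3 = b * d * y2 - τ / 2 := by rw [h3, hτ]; ring
    rw [this]; linear_combination ey2
  have e2 : 4 * v * ω2 = -σ * (v + (c ^ 2 - b ^ 2)) + τ * (d ^ 2 - a ^ 2 - v) := by
    have : ω2 = ω3 - σ / 2 := by rw [h2, h3, hσ]; ring
    rw [this]; linear_combination e3
  have hL' : c * (A1 * ω1 + J2 * ω2 + J3 * ω3) +
      q * (((a ^ 2 + b ^ 2 + d ^ 2 - c ^ 2) / 2 - 2 * a ^ 2 + b * d * y1) * ω1 +
        ((a ^ 2 + b ^ 2 + d ^ 2 - c ^ 2) / 2 - a * d * x1) * ω2) - 2 * p * ω1 * ω2 = 0 := by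
    have hk : (a ^ 2 + b ^ 2 + d ^ 2 - c ^ 2) / 2 =
        a * b * (x1 * y1 + x2 * y2) + a * d * x1 - b * d * y1 := by
      linear_combination hc / 2 - a ^ 2 / 2 * hx - b ^ 2 / 2 * hy
    rw [h1, h2, h3] at hL ⊢
    linear_combination hL + q * (b * (a * (y2 * x1 - y1 * x2) - d * y2) +
      a * (b * (y2 * x1 - y1 * x2) - d * x2)) * hk -
      q * a ^ 2 * (a * b * (y2 * x1 - y1 * x2) - b * (a * (y2 * x1 - y1 * x2) - d * y2)) * hx
  refine ⟨?_, hτ2, ?_⟩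
  · rw [hσ, hv]; linear_combination 4 * a ^ 2 * d ^ 2 * hx
  · rw [← hτ2]
    linear_combination 8 * v * hL' - (8 * v * (c * A1 + q * ((a ^ 2 + b ^ 2 + d ^ 2 - c ^ 2) / 2 -
      2 * a ^ 2 + b * d * y1)) - 16 * p * v * ω2) * e1 -
      (2 * c * J2 + 2 * q * ((a ^ 2 + b ^ 2 + d ^ 2 - c ^ 2) / 2 - a * d * x1) + 2 * p * τ) * e2 -
      2 * c * J3 * e3 + τ * q * ey1 +
      q * (-σ * (v + (c ^ 2 - b ^ 2)) + τ * (d ^ 2 - a ^ 2 - v)) * hx1 + q * σ * hτ2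

/-- The product of two quadratic polynomials with two distinct real zeros each has a simple zero,
unless the zeros are the same. -/
theorem exists_simple_root_mul {r₁ r₂ s₁ s₂ : ℝ} (hr : r₂ < r₁) (hs : s₂ < s₁)
    (h : ¬ (r₁ = s₁ ∧ r₂ = s₂)) {n w : Polynomial ℝ}
    (hn : n = -((Polynomial.X - Polynomial.C r₁) * (Polynomial.X - Polynomial.C r₂)))
    (hw : w = -((Polynomial.X - Polynomial.C s₁) * (Polynomial.X - Polynomial.C s₂))) :
    ∃ r, (n * w).eval r = 0 ∧ (n * w).derivative.eval r ≠ 0 := by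
  subst hn hw
  by_cases h1 : r₁ = s₁
  · subst h1
    have h2 : r₂ ≠ s₂ := fun e => h ⟨rfl, e⟩
    refine ⟨r₂, by simp, ?_⟩
    simpa [sub_eq_zero, h2] using hr.ne
  · by_cases h2 : r₁ = s₂
    · subst h2
      refine ⟨s₁, by simp, ?_⟩
      simp [sub_eq_zero, hs.ne', (hr.trans hs).ne']
    · refine ⟨r₁, by simp, ?_⟩
      simp [sub_eq_zero, hr.ne', h1, h2]

theorem exists_simple_root {r₁ r₂ : ℝ} (hr : r₂ < r₁) {n : Polynomial ℝ}
    (hn : n = -((Polynomial.X - Polynomial.C r₁) * (Polynomial.X - Polynomial.C r₂))) :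
    ∃ r, n.eval r = 0 ∧ n.derivative.eval r ≠ 0 := by
  subst hn
  refine ⟨r₁, by simp, ?_⟩
  simpa [sub_eq_zero] using hr.ne

namespace FourBar

variable {B : FourBar} {S : Set (ℂ × ℂ)}

/-- Unless the mechanism is a deltoid with `l1 = d`, the first link takes infinitely many
inclinations in an infinite set of configurations. -/
theorem infinite_image_fst_re (hS : S ⊆ B.configs) (hS' : S.Infinite) (h3 : ¬ B.CaseIII) :
    ((fun z : ℂ × ℂ => z.1.re) '' S).Infinite := by
  have h : (Prod.fst '' S).Infinite := fun hfin => hS' <| hfin.of_finite_fibers Prod.fst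
    fun k _ => by
      by_contra hinf
      exact h3 (caseIII_of_fst_eq (fun z hz => hS hz.1) hinf fun z hz => hz.2).1
  have h' : (Complex.re '' (Prod.fst '' S)).Infinite := fun hfin => h <|
    hfin.of_finite_fibers Complex.re fun t _ => by
      by_contra hinf
      obtain ⟨h0, -, -⟩ := quadratic_coeffs_eq_zero hinf (a := (1 : ℂ)) (b := -2 * t) (c := 1) (by
        rintro _ ⟨⟨z, hz, rfl⟩, ht⟩
        have hz1 := Complex.conj_mul_of_norm_one (hS hz).1
        have ht' : (z.1.re : ℂ) = t := by exact_mod_cast (show z.1.re = t from ht)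
        rw [Complex.re_eq_add_conj] at ht'
        linear_combination 2 * z.1 * ht' - hz1)
      exact one_ne_zero h0
  rwa [Set.image_image] at h'

theorem not_dynamicallyBalancedOn (hS : S ⊆ B.configs) (hS' : S.Infinite)
    (h2 : ¬ B.CaseII) (h3 : ¬ B.CaseIII) (h4 : ¬ B.CaseIV) : ¬ B.DynamicallyBalancedOn S := by
  rintro ⟨hst, hdyn⟩
  obtain ⟨hF1, hF2⟩ := (staticallyBalancedOn_iff_F_eq_zero hS hS' (fun h => h2 h.1)
    (fun h => h3 h.1) (fun h => h4 h.1)).1 hst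
  have a0 := B.l1_pos
  have b0 := B.l2_pos
  have c0 := B.l3_pos
  have d0 := B.d_pos
  have hq2 : B.l3 * B.q2 = -B.l2 * B.q3 := by
    have hc : (B.l3 : ℂ) ≠ 0 := by exact_mod_cast c0.ne'
    rw [F2_eq, G2] at hF2
    push_cast at hF2
    field_simp at hF2
    linear_combination hF2
  have hq2re := congrArg Complex.re hq2
  have hq2im := congrArg Complex.im hq2
  rw [← Complex.ofReal_neg, Complex.re_ofReal_mul, Complex.re_ofReal_mul] at hq2re
  rw [← Complex.ofReal_neg, Complex.im_ofReal_mul, Complex.im_ofReal_mul] at hq2im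
  set a := B.l1
  set b := B.l2
  set c := B.l3
  set d := B.d
  set q := B.q3.re
  set p := B.q3.im
  set A1 := B.J1 + B.m3 * a ^ 2
  have had : (a - d) ^ 2 < (a + d) ^ 2 := by nlinarith [mul_pos a0 d0]
  have hbc : (b - c) ^ 2 < (b + c) ^ 2 := by nlinarith [mul_pos b0 c0]
  have hT : ((fun t => a ^ 2 + d ^ 2 - 2 * a * d * t) ''
      ((fun z : ℂ × ℂ => z.1.re) '' S)).Infinite :=
    (infinite_image_fst_re hS hS' h3).image (Function.Injective.injOn fun s t hst => by
      have : 2 * (a * d) * (s - t) = 0 := by linear_combination -hst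
      simpa [a0.ne', d0.ne', sub_eq_zero] using this)
  open Polynomial in
  obtain ⟨-, e1, e2, e3⟩ := Polynomial.eq_zero_of_biquadratic
    (n := -((X - C ((a + d) ^ 2)) * (X - C ((a - d) ^ 2))))
    (w := -((X - C ((b + c) ^ 2)) * (X - C ((b - c) ^ 2))))
    (f₀ := C (2 * p) * (C (d ^ 2 - a ^ 2) - X) * -((X - C ((b + c) ^ 2)) * (X - C ((b - c) ^ 2))))
    (f₁ := C (2 * (c * (B.J3 - B.J2) - q * (b ^ 2 + c ^ 2))) * X +
      C (2 * (c ^ 2 - b ^ 2) * (q * (c ^ 2 - b ^ 2) - c * (B.J2 + B.J3))))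
    (g₀ := C (-4 * (c * A1 + q * ((a ^ 2 + b ^ 2 + d ^ 2 - c ^ 2) / 2 - 2 * a ^ 2))) * X -
      C q * (C (d ^ 2 - a ^ 2) + X) * (C (c ^ 2 - b ^ 2) - X) +
      C 2 * (C (c * (B.J2 + B.J3)) + C (q / 2) * (X - C (c ^ 2 - b ^ 2))) * (C (d ^ 2 - a ^ 2) - X))
    (g₁ := C (-2 * p) * (X + C (c ^ 2 - b ^ 2)))
    (exists_simple_root had rfl) (exists_simple_root hbc rfl)
    (exists_simple_root_mul had hbc
      (fun h => (B.caseII_or_caseIV_of_sq_eq h.1 h.2).elim h2 h4) rfl rfl) hT (by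
      rintro _ ⟨_, ⟨z, hz, rfl⟩, rfl⟩
      have hL := hdyn z hz _ _ _ (isVelocity_cross B z)
      rw [angularMomentum_eq (hS hz)] at hL
      have hre := B.l3_mul_z3_re z
      have him := B.l3_mul_z3_im z
      have hx := Complex.sq_add_sq_of_norm_one (hS hz).1
      obtain ⟨k1, k2, k3⟩ := angularMomentum_expansion (a := a) (b := b) (c := c) (d := d)
        (q := q) (p := p) (A1 := A1) (J2 := B.J2) (J3 := B.J3)
        hx (Complex.sq_add_sq_of_norm_one (hS hz).2.1) (closure_re_im (hS hz))
        rfl rfl rfl rfl rfl rfl (by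
          simp only [Complex.mul_re, Complex.mul_im, Complex.conj_re, Complex.conj_im] at hL
          linear_combination c * hL -
            d * (a * (b * (z.2.im * z.1.re - z.2.re * z.1.im) - d * z.1.im)) *
              (z.2.re * hq2re - z.2.im * hq2im) -
            a * (b * (a * (z.2.im * z.1.re - z.2.re * z.1.im) - d * z.2.im) +
              a * b * (z.2.im * z.1.re - z.2.re * z.1.im)) *
              ((q * z.1.re + p * z.1.im) * hre + (q * z.1.im - p * z.1.re) * him - a * q * hx))
      exact ⟨_, _, by simpa using k1, by simpa using k2, by
        simp only [eval_add, eval_mul, eval_sub, eval_C, eval_X, eval_neg]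
        linear_combination k3⟩)
  have hp : p = 0 := by
    have := congrArg (Polynomial.eval (1 - (c ^ 2 - b ^ 2))) e3
    simpa using this
  have k1 : c * (B.J3 - B.J2) = q * (b ^ 2 + c ^ 2) := by
    have h0 := congrArg (Polynomial.eval 0) e1
    have h1 := congrArg (Polynomial.eval 1) e1
    simp only [Polynomial.eval_add, Polynomial.eval_mul, Polynomial.eval_C, Polynomial.eval_X,
      Polynomial.eval_zero] at h0 h1
    linarith
  have k2 : (c ^ 2 - b ^ 2) * (q * (c ^ 2 - b ^ 2) - c * (B.J2 + B.J3)) = 0 := by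
    have := congrArg (Polynomial.eval 0) e1
    simp only [Polynomial.eval_add, Polynomial.eval_mul, Polynomial.eval_C, Polynomial.eval_X,
      Polynomial.eval_zero] at this
    linarith
  have k3 : (d ^ 2 - a ^ 2) * (q * (c ^ 2 - b ^ 2) - c * (B.J2 + B.J3)) = 0 := by
    have := congrArg (Polynomial.eval 0) e2
    simp only [Polynomial.eval_add, Polynomial.eval_mul, Polynomial.eval_sub, Polynomial.eval_C,
      Polynomial.eval_X, Polynomial.eval_zero] at this
    linear_combination -this / 2
  have hJ2 := B.J2_pos
  have hJ3 := B.J3_pos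
  have hne : q * (c ^ 2 - b ^ 2) - c * (B.J2 + B.J3) ≠ 0 := by
    intro h
    have h5 : c * B.J2 = -q * b ^ 2 := by linarith
    have h6 : c * B.J3 = q * c ^ 2 := by linarith
    have h7 : 0 < q := by
      have : 0 < q * c ^ 2 := h6 ▸ mul_pos c0 hJ3
      exact pos_of_mul_pos_left this (by positivity)
    nlinarith [mul_pos c0 hJ2, mul_pos h7 (pow_pos b0 2)]
  have k2' := (mul_eq_zero.1 k2).resolve_right hne
  have k3' := (mul_eq_zero.1 k3).resolve_right hne
  exact h3 ⟨(sq_eq_sq₀ a0.le d0.le).1 (by linarith), (sq_eq_sq₀ b0.le c0.le).1 (by linarith)⟩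

end FourBar

/-! ### The modes in which the mechanism can be dynamically balanced -/

theorem trigPoly_coeffs_eq_zero_re_im {T : Set ℂ} (hT : T.Infinite) (hT1 : ∀ z ∈ T, ‖z‖ = 1)
    {c₀ c₁ c₂ c₃ : ℝ} (h : ∀ z ∈ T, c₀ + c₁ * z.re + c₂ * z.im + c₃ * (z.re * z.im) = 0) :
    c₀ = 0 ∧ c₁ = 0 ∧ c₂ = 0 ∧ c₃ = 0 := by
  obtain ⟨h0, h1, h2⟩ := trigPoly_coeffs_eq_zero hT hT1 (a := c₀) (b := ⟨c₁, -c₂⟩)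
    (c := ⟨0, -c₃ / 2⟩) (fun z hz => by
      have := h z hz
      simp only [sq, Complex.mul_re, Complex.mul_im]
      linear_combination this)
  have h1r := congrArg Complex.re h1
  have h1i := congrArg Complex.im h1
  have h2i := congrArg Complex.im h2
  simp at h1r h1i h2i
  exact ⟨h0, h1r, h1i, h2i⟩

theorem exists_multiple_iff {E D F u v w : ℝ} (hD : D ≠ 0) :
    (u * D = E * v ∧ w * D = F * v) ↔ ∃ t, u = t * E ∧ v = t * D ∧ w = t * F := by
  constructor
  · rintro ⟨h1, h2⟩
    refine ⟨v / D, ?_, ?_, ?_⟩ <;> field_simp <;> linarith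
  · rintro ⟨t, rfl, rfl, rfl⟩
    exact ⟨by ring, by ring⟩

/-- The complex conjugate of a velocity equation between unit vectors. -/
theorem conj_velocity_iff {M Y : ℂ} (hM : ‖M‖ = 1) (hY : ‖Y‖ = 1) (l d u v w : ℝ) :
    (d * (M * Y) * w : ℂ) = -l * M * u + l * Y * v ↔ (d * w : ℂ) = -l * Y * u + l * M * v := by
  have hM := Complex.conj_mul_of_norm_one hM
  have hY := Complex.conj_mul_of_norm_one hY
  constructor <;> intro h <;> have h' := congrArg (starRingEnd ℂ) h <;>
    simp only [map_mul, map_add, map_neg, Complex.conj_ofReal] at h'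
  · linear_combination M * Y * h' - d * w * (starRingEnd ℂ Y * Y * hM + hY) - l * Y * u * hM +
      l * M * v * hY
  · linear_combination M * Y * h' - l * M * u * hY + l * Y * v * hM

/-- In each of the modes below, two of the directions involved are related by the automorphism
`Y ↦ (l Y + d) / (l + d Y)` of the unit circle; its logarithmic derivative at `Y` is `E / D` with
`E = l ^ 2 - d ^ 2` and `D = |l + d Y| ^ 2`. This determines the ratios of the joint velocities. -/
theorem moebius_velocity_iff {l d : ℝ} (hd : 0 < d) (hld : l ≠ d) {Y M : ℂ} (hl : 0 < l)
    (hY : ‖Y‖ = 1) (hM1 : ‖M‖ = 1) (hM : M * (l + d * Y) = l * Y + d) (hY2 : Y ^ 2 ≠ 1)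
    (u v w : ℝ) : (d * (M * Y) * w : ℂ) = -l * M * u + l * Y * v ↔
      ∃ t, u = t * (l ^ 2 - d ^ 2) ∧ v = t * (l ^ 2 + d ^ 2 + 2 * l * d * Y.re) ∧
        w = t * (2 * l ^ 2 + 2 * l * d * Y.re) := by
  rw [conj_velocity_iff hM1 hY]
  have hYc := Complex.conj_mul_of_norm_one hY
  have hY0 : Y ≠ 0 := by rintro rfl; simp at hY
  have hD0 : l ^ 2 + d ^ 2 + 2 * l * d * Y.re ≠ 0 := by
    have h1 : -1 ≤ Y.re := by
      have := Complex.abs_re_le_norm Y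
      rw [hY] at this
      exact (abs_le.1 this).1
    have h2 : 0 < (l - d) ^ 2 := by
      have := sub_ne_zero.2 hld
      positivity
    nlinarith [mul_pos hl hd]
  obtain ⟨D, hD⟩ : ∃ D : ℝ, D = l ^ 2 + d ^ 2 + 2 * l * d * Y.re := ⟨_, rfl⟩
  have hDE : 2 * l ^ 2 + 2 * l * d * Y.re = D + (l ^ 2 - d ^ 2) := by rw [hD]; ring
  rw [← hD] at hD0
  rw [hDE, ← hD, ← exists_multiple_iff hD0]
  have hDc : (D : ℂ) * Y = (l * Y + d) * (l + d * Y) := by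
    rw [hD]; push_cast
    rw [Complex.re_eq_add_conj]
    linear_combination (l * d : ℂ) * hYc
  have hDY : (D : ℂ) * Y ≠ 0 := mul_ne_zero (by exact_mod_cast hD0) hY0
  have hMD : M * (D * Y) = (l * Y + d) ^ 2 := by
    rw [hDc]; linear_combination (l * Y + d) * hM
  constructor
  · intro h
    have hM' := congrArg (starRingEnd ℂ) hM
    have h' := congrArg (starRingEnd ℂ) h
    simp only [map_mul, map_add, map_neg, Complex.conj_ofReal] at hM' h'
    have hMD' : starRingEnd ℂ M * (D * Y) = (l + d * Y) ^ 2 := by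
      rw [hDc]
      linear_combination (l + d * Y) * Y * hM' -
        (l + d * Y) * (d * starRingEnd ℂ M - l) * hYc
    have e1 : u * D = (l ^ 2 - d ^ 2) * v := by
      have : (Y ^ 2 - 1) * ((u * D : ℂ) - (l ^ 2 - d ^ 2) * v) = 0 := by
        have hl' : (l : ℂ) ≠ 0 := by exact_mod_cast hl.ne'
        refine mul_left_cancel₀ hl' ?_
        linear_combination D * Y * (h - h') + l * D * u * hYc + l * v * (hMD - hMD')
      have := (mul_eq_zero.1 this).resolve_left (sub_ne_zero.2 hY2)
      exact_mod_cast sub_eq_zero.1 this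
    refine ⟨e1, ?_⟩
    have e1' : (u * D : ℂ) = (l ^ 2 - d ^ 2) * v := by exact_mod_cast e1
    have hd' : (d : ℂ) ≠ 0 := by exact_mod_cast hd.ne'
    have : (w * D : ℂ) = (D + (l ^ 2 - d ^ 2)) * v := by
      refine mul_left_cancel₀ hd' (mul_left_cancel₀ hY0 ?_)
      linear_combination D * Y * h + l * v * hMD - l * Y ^ 2 * e1' - d * v * hDc
    exact_mod_cast this
  · rintro ⟨e1, e2⟩
    have e1' : (u * D : ℂ) = (l ^ 2 - d ^ 2) * v := by exact_mod_cast e1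
    have e2' : (w * D : ℂ) = (D + (l ^ 2 - d ^ 2)) * v := by exact_mod_cast e2
    refine mul_left_cancel₀ hDY ?_
    linear_combination d * Y * e2' + l * Y ^ 2 * e1' - l * v * hMD + d * v * hDc

/-- The automorphism `Y ↦ (l Y + d) / (l + d Y)` fixes `1` and `-1`. -/
theorem moebius_of_sq_eq_one {l d : ℝ} (hl : 0 < l) (hd : 0 < d) (hld : l ≠ d) {Y M : ℂ}
    (hM : M * (l + d * Y) = l * Y + d) (hY2 : Y ^ 2 = 1) : M = Y := by
  have h1 : (l + d * Y : ℂ) ≠ 0 := by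
    intro h
    have h2 : (d : ℂ) ^ 2 = l ^ 2 := by linear_combination (d * Y - l) * h - d ^ 2 * hY2
    have h3 : d ^ 2 = l ^ 2 := by exact_mod_cast h2
    exact hld ((sq_eq_sq₀ hd.le hl.le).1 h3).symm
  refine mul_right_cancel₀ h1 ?_
  linear_combination hM - d * hY2

namespace FourBar

variable {B : FourBar} {S : Set (ℂ × ℂ)}

theorem isVelocity_iff (z : ℂ × ℂ) (ω1 ω2 ω3 : ℝ) : B.IsVelocity z ω1 ω2 ω3 ↔
    B.l3 * B.z3 z * ω3 = -B.l1 * z.1 * ω1 + B.l2 * z.2 * ω2 := by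
  have hc : (B.l3 : ℂ) ≠ 0 := B.ofReal_lengths_ne_zero.2.2.1
  rw [IsVelocity, ← mul_right_inj' hc, G1, G2]
  push_cast
  field_simp

theorem l3_mul_z3 (B : FourBar) (z : ℂ × ℂ) :
    B.l3 * B.z3 z = -B.l1 * z.1 + B.l2 * z.2 + B.d := by
  have hc : (B.l3 : ℂ) ≠ 0 := B.ofReal_lengths_ne_zero.2.2.1
  rw [z3, G1, G2, G3]
  push_cast
  field_simp

/-- If the velocities in each configuration are the multiples of one of them, then the angular
momentum need only be tested on that one. -/
theorem dynamicallyBalancedOn_iff_of_velocity (hS : S ⊆ B.configs) (k1 k2 k3 : ℂ × ℂ → ℝ)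
    (hk : ∀ z ∈ S, ∀ ω1 ω2 ω3, B.IsVelocity z ω1 ω2 ω3 ↔
      ∃ t, ω1 = t * k1 z ∧ ω2 = t * k2 z ∧ ω3 = t * k3 z) :
    B.DynamicallyBalancedOn S ↔ B.StaticallyBalancedOn S ∧
      ∀ z ∈ S, B.angularMomentum z (k1 z) (k2 z) (k3 z) = 0 := by
  refine and_congr_right fun _ => forall₂_congr fun z hz => ⟨fun h => ?_, fun h => ?_⟩
  · exact h _ _ _ ((hk z hz _ _ _).2 ⟨1, by simp⟩)
  · intro ω1 ω2 ω3 hω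
    obtain ⟨t, rfl, rfl, rfl⟩ := (hk z hz _ _ _).1 hω
    rw [angularMomentum_eq (hS hz)] at h ⊢
    linear_combination t * h

theorem infinite_image_snd (hS : S ⊆ B.configs) (hS' : S.Infinite) (h4 : ¬ B.CaseIV) :
    (Prod.snd '' S).Infinite := fun hfin => hS' <| hfin.of_finite_fibers Prod.snd fun k _ => by
  by_contra hinf
  exact h4 (caseIV_of_snd_eq (fun z hz => hS hz.1) hinf fun z hz => hz.2).1

theorem infinite_image_fst (hS : S ⊆ B.configs) (hS' : S.Infinite) (h3 : ¬ B.CaseIII) :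
    (Prod.fst '' S).Infinite := fun hfin => hS' <| hfin.of_finite_fibers Prod.fst fun k _ => by
  by_contra hinf
  exact h3 (caseIII_of_fst_eq (fun z hz => hS hz.1) hinf fun z hz => hz.2).1

/-- The closure equation without the factor `z1 - z2` of the parallelogram mode. -/
theorem antiparallelogram_closure (h : B.CaseII) {z : ℂ × ℂ} (hz : z ∈ B.configs)
    (hne : z.1 ≠ z.2) : z.1 * (B.l1 + B.d * z.2) = B.l1 * z.2 + B.d := by
  obtain ⟨h12, h3d⟩ := h
  have hb := B.ofReal_lengths_ne_zero.2.1
  have e := quadratic_of_mem_configs hz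
  rw [h3d, h12] at e
  rw [h12]
  refine mul_left_cancel₀ (mul_ne_zero hb (sub_ne_zero.2 hne)) ?_
  linear_combination -e

/-- The closure equation without the factor `z1 - 1` of the degenerate deltoid mode. -/
theorem deltoid_closure (h : B.CaseIII) {z : ℂ × ℂ} (hz : z ∈ B.configs)
    (hne : z.1 ≠ 1) : z.1 * (B.l2 + B.d * z.2) = z.2 * (B.l2 * z.2 + B.d) := by
  obtain ⟨h1d, h23⟩ := h
  have hd := B.ofReal_lengths_ne_zero.2.2.2
  have e := quadratic_of_mem_configs hz
  rw [h1d, ← h23] at e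
  refine mul_left_cancel₀ (mul_ne_zero hd (sub_ne_zero.2 hne)) ?_
  linear_combination -e

/-- The closure equation without the factor `z2 + 1` of the degenerate deltoid mode. -/
theorem deltoid_closure' (h : B.CaseIV) {z : ℂ × ℂ} (hz : z ∈ B.configs)
    (hne : z.2 ≠ -1) : z.2 * (B.l1 - B.d * z.1) = z.1 * (B.d - B.l1 * z.1) := by
  obtain ⟨h2d, h13⟩ := h
  have hd := B.ofReal_lengths_ne_zero.2.2.2
  have e := quadratic_of_mem_configs hz
  rw [h2d, ← h13] at e
  refine mul_left_cancel₀ (mul_ne_zero hd (sub_ne_zero.2 hne)) ?_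
  linear_combination -e

theorem antiparallelogram_z3 (h : B.CaseII) {z : ℂ × ℂ} (hz : z ∈ B.configs)
    (hne : z.1 ≠ z.2) : B.z3 z = z.1 * z.2 := by
  have e := B.l3_mul_z3 z
  have e' := antiparallelogram_closure h hz hne
  refine mul_left_cancel₀ B.ofReal_lengths_ne_zero.2.2.2 ?_
  rw [h.2, ← h.1] at e
  linear_combination e - e'

theorem deltoid_z3 (h : B.CaseIII) {z : ℂ × ℂ} (hz : z ∈ B.configs)
    (hne : z.1 ≠ 1) : B.z3 z * z.2 = z.1 := by
  have e := B.l3_mul_z3 z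
  have e' := deltoid_closure h hz hne
  refine mul_left_cancel₀ B.ofReal_lengths_ne_zero.2.1 ?_
  rw [← h.2, h.1] at e
  linear_combination z.2 * e - e'

theorem deltoid_z3' (h : B.CaseIV) {z : ℂ × ℂ} (hz : z ∈ B.configs)
    (hne : z.2 ≠ -1) : B.z3 z * z.1 = z.2 := by
  have e := B.l3_mul_z3 z
  have e' := deltoid_closure' h hz hne
  refine mul_left_cancel₀ B.ofReal_lengths_ne_zero.1 ?_
  rw [← h.2, h.1] at e
  linear_combination z.1 * e - e'


theorem q2_re_im (h : B.F2 = 0) :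
    B.l3 * B.q2.re = -B.l2 * B.q3.re ∧ B.l3 * B.q2.im = -B.l2 * B.q3.im := by
  have hc := B.ofReal_lengths_ne_zero.2.2.1
  have hq2 : B.l3 * B.q2 = -B.l2 * B.q3 := by
    rw [F2_eq, G2] at h
    push_cast at h
    field_simp at h
    linear_combination h
  have hre := congrArg Complex.re hq2
  have him := congrArg Complex.im hq2
  rw [← Complex.ofReal_neg, Complex.re_ofReal_mul, Complex.re_ofReal_mul] at hre
  rw [← Complex.ofReal_neg, Complex.im_ofReal_mul, Complex.im_ofReal_mul] at him
  exact ⟨hre, him⟩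

theorem ofReal_eq_mul_iff {J a b : ℝ} {q : ℂ} :
    (J : ℂ) = a * q - b ↔ J = a * q.re - b ∧ a * q.im = 0 := by
  rw [Complex.ext_iff]
  simp [eq_comm]

/-- Antiparallelogram mode. -/
theorem dynamicallyBalancedOn_iff_of_caseII (h : B.CaseII) (hne : B.l1 ≠ B.l3)
    (hS : S ⊆ B.configs) (hS' : S.Infinite) (hmode : ∀ z ∈ S, z.1 ≠ z.2) :
    (B.StaticallyBalancedOn S ↔ B.F1 = 0 ∧ B.F2 = 0) ∧
      (B.DynamicallyBalancedOn S ↔ B.LinearConditionsII B.l1) := by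
  obtain ⟨h12, h3d⟩ := id h
  have l0 := B.l1_pos
  have d0 := B.d_pos
  have h4 : ¬ B.CaseIV := fun h4 => hne h4.2
  have hst := staticallyBalancedOn_iff_F_eq_zero hS hS'
    (fun ⟨_, h'⟩ => by obtain ⟨z, hz⟩ := hS'.nonempty; exact hmode z hz (h' z hz))
    (fun h' => hne (h'.1.1.trans h3d.symm)) (fun h' => h4 h'.1)
  refine ⟨hst, ?_⟩
  have hld : B.l1 ≠ B.d := h3d ▸ hne
  have hE : B.l1 ^ 2 - B.d ^ 2 ≠ 0 := fun h' =>
    hld ((sq_eq_sq₀ l0.le d0.le).1 (sub_eq_zero.1 h'))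
  have hvel : ∀ z ∈ S, ∀ ω1 ω2 ω3, B.IsVelocity z ω1 ω2 ω3 ↔ ∃ t,
      ω1 = t * (B.l1 ^ 2 - B.d ^ 2) ∧
      ω2 = t * (B.l1 ^ 2 + B.d ^ 2 + 2 * B.l1 * B.d * z.2.re) ∧
      ω3 = t * (2 * B.l1 ^ 2 + 2 * B.l1 * B.d * z.2.re) := by
    intro z hz ω1 ω2 ω3
    have hcl := antiparallelogram_closure h (hS hz) (hmode z hz)
    have hy2 : z.2 ^ 2 ≠ 1 := fun h' => hmode z hz (moebius_of_sq_eq_one l0 d0 hld hcl h')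
    rw [← moebius_velocity_iff d0 hld l0 (hS hz).2.1 (hS hz).1 hcl hy2, isVelocity_iff,
      antiparallelogram_z3 h (hS hz) (hmode z hz), ← h12, h3d]
  rw [dynamicallyBalancedOn_iff_of_velocity hS _ _ _ hvel, hst]
  have hL : B.F2 = 0 → ∀ z ∈ S, B.angularMomentum z (B.l1 ^ 2 - B.d ^ 2)
      (B.l1 ^ 2 + B.d ^ 2 + 2 * B.l1 * B.d * z.2.re) (2 * B.l1 ^ 2 + 2 * B.l1 * B.d * z.2.re) =
      ((B.J1 + B.m3 * B.l1 ^ 2 + B.J3) * (B.l1 ^ 2 - B.d ^ 2) +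
        (B.J2 + B.J3) * (B.l1 ^ 2 + B.d ^ 2)) +
      (2 * B.l1 * (B.d * (B.J2 + B.J3) + (B.l1 ^ 2 - B.d ^ 2) * B.q3.re)) * z.2.re +
      (-2 * B.l1 * (B.l1 ^ 2 - B.d ^ 2) * B.q3.im) * z.2.im + 0 * (z.2.re * z.2.im) := by
    intro hF z hz
    obtain ⟨k1, k2⟩ := q2_re_im hF
    rw [h3d, ← h12] at k1 k2
    have hx := Complex.conj_mul_of_norm_one (hS hz).1
    rw [angularMomentum_eq (hS hz), antiparallelogram_z3 h (hS hz) (hmode z hz),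
      show B.q3 * (z.1 * z.2) * starRingEnd ℂ z.1 = B.q3 * z.2 by
        linear_combination B.q3 * z.2 * hx, Complex.mul_re, Complex.mul_re]
    linear_combination (B.l1 ^ 2 + B.d ^ 2 + 2 * B.l1 * B.d * z.2.re) * (z.2.re * k1 - z.2.im * k2)
  have hcoef : B.F2 = 0 → ((∀ z ∈ S, B.angularMomentum z (B.l1 ^ 2 - B.d ^ 2)
      (B.l1 ^ 2 + B.d ^ 2 + 2 * B.l1 * B.d * z.2.re) (2 * B.l1 ^ 2 + 2 * B.l1 * B.d * z.2.re) = 0) ↔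
      (B.J1 + B.m3 * B.l1 ^ 2 + B.J3) * (B.l1 ^ 2 - B.d ^ 2) +
        (B.J2 + B.J3) * (B.l1 ^ 2 + B.d ^ 2) = 0 ∧
      B.d * (B.J2 + B.J3) + (B.l1 ^ 2 - B.d ^ 2) * B.q3.re = 0 ∧ B.q3.im = 0) := by
    intro hF
    constructor
    · intro h0
      obtain ⟨e0, e1, e2, -⟩ := trigPoly_coeffs_eq_zero_re_im (infinite_image_snd hS hS' h4)
        (by rintro _ ⟨z, hz, rfl⟩; exact (hS hz).2.1) (by
          rintro _ ⟨z, hz, rfl⟩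
          rw [← hL hF z hz]
          exact h0 z hz)
      exact ⟨e0, (mul_eq_zero.1 e1).resolve_left (by positivity),
        (mul_eq_zero.1 e2).resolve_left (mul_ne_zero (by simpa using l0.ne') hE)⟩
    · rintro ⟨e0, e1, e2⟩ z hz
      rw [hL hF z hz, e0, e1, e2]
      ring
  have hF1 : B.F1 = 0 ↔ B.q1 = B.l1 / B.d * B.q3 - B.l1 * B.m3 := by
    rw [F1_eq, G1, h3d]; push_cast
    constructor <;> intro h' <;> linear_combination h'
  have hF2 : B.F2 = 0 ↔ B.q2 = -(B.l1 / B.d) * B.q3 := by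
    rw [F2_eq, G2, h3d, ← h12]; push_cast
    constructor <;> intro h' <;> linear_combination h'
  have hJ1 : (B.J1 : ℂ) = (B.d ^ 2 + B.l1 ^ 2) / B.d * B.q3 - B.J3 - B.l1 ^ 2 * B.m3 ↔
      B.J1 = (B.d ^ 2 + B.l1 ^ 2) / B.d * B.q3.re - (B.J3 + B.l1 ^ 2 * B.m3) ∧
      (B.d ^ 2 + B.l1 ^ 2) / B.d * B.q3.im = 0 := by
    rw [← ofReal_eq_mul_iff]; push_cast; rw [sub_sub]
  have hJ2 : (B.J2 : ℂ) = (B.d ^ 2 - B.l1 ^ 2) / B.d * B.q3 - B.J3 ↔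
      B.J2 = (B.d ^ 2 - B.l1 ^ 2) / B.d * B.q3.re - B.J3 ∧
      (B.d ^ 2 - B.l1 ^ 2) / B.d * B.q3.im = 0 := by
    rw [← ofReal_eq_mul_iff]; push_cast; rfl
  rw [LinearConditionsII, ← hF1, ← hF2, hJ1, hJ2, and_assoc]
  refine and_congr_right fun _ => and_congr_right fun hF => ?_
  rw [hcoef hF]
  constructor
  · rintro ⟨e0, e1, e2⟩
    have k2 : B.J2 = (B.d ^ 2 - B.l1 ^ 2) / B.d * B.q3.re - B.J3 := by
      field_simp; linear_combination e1
    refine ⟨⟨?_, by rw [e2, mul_zero]⟩, k2, by rw [e2, mul_zero]⟩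
    have hd : B.d * ((B.d ^ 2 + B.l1 ^ 2) / B.d) = B.d ^ 2 + B.l1 ^ 2 := by field_simp
    refine mul_left_cancel₀ hE (mul_left_cancel₀ d0.ne' ?_)
    linear_combination B.d * e0 - (B.l1 ^ 2 + B.d ^ 2) * e1 -
      (B.l1 ^ 2 - B.d ^ 2) * B.q3.re * hd
  · rintro ⟨⟨k1, k3⟩, k2, -⟩
    rw [k1, k2]
    refine ⟨by field_simp; ring, by field_simp; ring, (mul_eq_zero.1 k3).resolve_left ?_⟩
    positivity


/-- Deltoid lengths with `l1 = d`, in the mode that is not degenerate. -/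
theorem dynamicallyBalancedOn_iff_of_caseIII (h : B.CaseIII) (hne : B.l1 ≠ B.l2)
    (hS : S ⊆ B.configs) (hS' : S.Infinite) (hmode : ∀ z ∈ S, z.1 ≠ 1) :
    (B.StaticallyBalancedOn S ↔ B.F1 = 0 ∧ B.F2 = 0) ∧
      (B.DynamicallyBalancedOn S ↔ B.LinearConditionsIII B.l2) := by
  obtain ⟨h1d, h23⟩ := id h
  have l0 := B.l2_pos
  have d0 := B.d_pos
  have hld : B.l2 ≠ B.d := fun h' => hne (h1d.trans h'.symm)
  have h4 : ¬ B.CaseIV := fun h4 => hld h4.1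
  have hst := staticallyBalancedOn_iff_F_eq_zero hS hS' (fun h' => hne h'.1.1)
    (fun ⟨_, h'⟩ => by obtain ⟨z, hz⟩ := hS'.nonempty; exact hmode z hz (h' z hz))
    (fun h' => h4 h'.1)
  refine ⟨hst, ?_⟩
  have hE : B.l2 ^ 2 - B.d ^ 2 ≠ 0 := fun h' =>
    hld ((sq_eq_sq₀ l0.le d0.le).1 (sub_eq_zero.1 h'))
  have hvel : ∀ z ∈ S, ∀ ω1 ω2 ω3, B.IsVelocity z ω1 ω2 ω3 ↔ ∃ t,
      ω1 = t * (2 * B.l2 ^ 2 + 2 * B.l2 * B.d * z.2.re) ∧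
      ω2 = t * (B.l2 ^ 2 + B.d ^ 2 + 2 * B.l2 * B.d * z.2.re) ∧
      ω3 = t * (B.l2 ^ 2 - B.d ^ 2) := by
    intro z hz ω1 ω2 ω3
    have hz3 := deltoid_z3 h (hS hz) (hmode z hz)
    have hy0 : z.2 ≠ 0 := fun h' => by have := (hS hz).2.1; simp [h'] at this
    have hcl : B.z3 z * (B.l2 + B.d * z.2) = B.l2 * z.2 + B.d := by
      have := deltoid_closure h (hS hz) (hmode z hz)
      refine mul_left_cancel₀ hy0 ?_
      linear_combination this + (B.l2 + B.d * z.2) * hz3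
    have hy2 : z.2 ^ 2 ≠ 1 := fun h' => hmode z hz <| by
      rw [← hz3, moebius_of_sq_eq_one l0 d0 hld hcl h', ← sq, h']
    have hv := moebius_velocity_iff d0 hld l0 (hS hz).2.1 (norm_z3_of_mem_configs (hS hz))
      hcl hy2 ω3 ω2 ω1
    rw [isVelocity_iff, ← h23, h1d]
    refine Iff.trans ?_ (hv.trans (exists_congr fun t => by tauto))
    rw [hz3]
    constructor <;> intro h' <;> linear_combination h'
  rw [dynamicallyBalancedOn_iff_of_velocity hS _ _ _ hvel, hst]
  have hL : B.F2 = 0 → ∀ z ∈ S, B.angularMomentum z (2 * B.l2 ^ 2 + 2 * B.l2 * B.d * z.2.re)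
      (B.l2 ^ 2 + B.d ^ 2 + 2 * B.l2 * B.d * z.2.re) (B.l2 ^ 2 - B.d ^ 2) =
      (2 * B.l2 ^ 2 * (B.J1 + B.m3 * B.d ^ 2 + B.J2) +
        (B.l2 ^ 2 - B.d ^ 2) * (B.J3 - B.J2)) +
      (2 * B.d * (B.l2 * (B.J1 + B.m3 * B.d ^ 2 + B.J2) +
        (B.l2 ^ 2 - B.d ^ 2) * B.q3.re)) * z.2.re +
      (4 * B.d * B.l2 ^ 2 * B.q3.im) * z.2.im +
      (4 * B.d ^ 2 * B.l2 * B.q3.im) * (z.2.re * z.2.im) := by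
    intro hF z hz
    obtain ⟨k1, k2⟩ := q2_re_im hF
    rw [← h23] at k1 k2
    have e1 : B.q2.re = -B.q3.re := mul_left_cancel₀ l0.ne' (by linear_combination k1)
    have e2 : B.q2.im = -B.q3.im := mul_left_cancel₀ l0.ne' (by linear_combination k2)
    have hz3 := deltoid_z3 h (hS hz) (hmode z hz)
    have hw := Complex.conj_mul_of_norm_one (norm_z3_of_mem_configs (hS hz))
    rw [angularMomentum_eq (hS hz), show B.q3 * B.z3 z * starRingEnd ℂ z.1 =
        B.q3 * starRingEnd ℂ z.2 by
          rw [← hz3, map_mul]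
          linear_combination B.q3 * starRingEnd ℂ z.2 * hw, Complex.mul_re, Complex.mul_re,
      Complex.conj_re, Complex.conj_im, e1, e2, h1d]
    ring
  have hcoef : B.F2 = 0 → ((∀ z ∈ S, B.angularMomentum z
      (2 * B.l2 ^ 2 + 2 * B.l2 * B.d * z.2.re)
      (B.l2 ^ 2 + B.d ^ 2 + 2 * B.l2 * B.d * z.2.re) (B.l2 ^ 2 - B.d ^ 2) = 0) ↔
      2 * B.l2 ^ 2 * (B.J1 + B.m3 * B.d ^ 2 + B.J2) +
        (B.l2 ^ 2 - B.d ^ 2) * (B.J3 - B.J2) = 0 ∧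
      B.l2 * (B.J1 + B.m3 * B.d ^ 2 + B.J2) + (B.l2 ^ 2 - B.d ^ 2) * B.q3.re = 0 ∧
      B.q3.im = 0) := by
    intro hF
    constructor
    · intro h0
      obtain ⟨e0, e1, e2, -⟩ := trigPoly_coeffs_eq_zero_re_im (infinite_image_snd hS hS' h4)
        (by rintro _ ⟨z, hz, rfl⟩; exact (hS hz).2.1) (by
          rintro _ ⟨z, hz, rfl⟩
          rw [← hL hF z hz]
          exact h0 z hz)
      exact ⟨e0, (mul_eq_zero.1 e1).resolve_left (by positivity),
        (mul_eq_zero.1 e2).resolve_left (by positivity)⟩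
    · rintro ⟨e0, e1, e2⟩ z hz
      rw [hL hF z hz, e0, e1, e2]
      ring
  have hF1 : B.F1 = 0 ↔ B.q1 = B.d / B.l2 * B.q3 - B.d * B.m3 := by
    rw [F1_eq, G1, ← h23, h1d]; push_cast
    constructor <;> intro h' <;> linear_combination h'
  have hF2 : B.F2 = 0 ↔ B.q2 = -B.q3 := by
    rw [F2_eq, G2, ← h23, div_self l0.ne', Complex.ofReal_one, one_mul]
    exact add_eq_zero_iff_eq_neg
  have hJ1 : (B.J1 : ℂ) = (B.d ^ 2 + B.l2 ^ 2) / B.l2 * B.q3 - B.J3 - B.d ^ 2 * B.m3 ↔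
      B.J1 = (B.d ^ 2 + B.l2 ^ 2) / B.l2 * B.q3.re - (B.J3 + B.d ^ 2 * B.m3) ∧
      (B.d ^ 2 + B.l2 ^ 2) / B.l2 * B.q3.im = 0 := by
    rw [← ofReal_eq_mul_iff]; push_cast; rw [sub_sub]
  have hJ2 : (B.J2 : ℂ) = B.J3 - 2 * B.l2 * B.q3 ↔
      B.J2 = (-2 * B.l2) * B.q3.re - -B.J3 ∧ (-2 * B.l2) * B.q3.im = 0 := by
    rw [← ofReal_eq_mul_iff]; push_cast
    constructor <;> intro h' <;> linear_combination h'
  rw [LinearConditionsIII, ← hF1, ← hF2, hJ1, hJ2, and_assoc]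
  refine and_congr_right fun _ => and_congr_right fun hF => ?_
  rw [hcoef hF]
  have hd : B.l2 * ((B.d ^ 2 + B.l2 ^ 2) / B.l2) = B.d ^ 2 + B.l2 ^ 2 := by field_simp
  constructor
  · rintro ⟨e0, e1, e2⟩
    have k2 : B.J2 = (-2 * B.l2) * B.q3.re - -B.J3 := by
      refine mul_left_cancel₀ hE ?_
      linear_combination 2 * B.l2 * e1 - e0
    refine ⟨⟨?_, by rw [e2, mul_zero]⟩, k2, by rw [e2, mul_zero]⟩
    refine mul_left_cancel₀ l0.ne' ?_
    linear_combination e1 - B.q3.re * hd - B.l2 * k2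
  · rintro ⟨⟨k1, k3⟩, k2, -⟩
    have e1 : B.l2 * (B.J1 + B.m3 * B.d ^ 2 + B.J2) + (B.l2 ^ 2 - B.d ^ 2) * B.q3.re = 0 := by
      linear_combination B.l2 * k1 + B.l2 * k2 + B.q3.re * hd
    refine ⟨?_, e1, (mul_eq_zero.1 k3).resolve_left (by positivity)⟩
    linear_combination 2 * B.l2 * e1 - (B.l2 ^ 2 - B.d ^ 2) * k2

/-- Deltoid lengths with `l2 = d`, in the mode that is not degenerate. -/
theorem dynamicallyBalancedOn_iff_of_caseIV (h : B.CaseIV) (hne : B.l1 ≠ B.l2)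
    (hS : S ⊆ B.configs) (hS' : S.Infinite) (hmode : ∀ z ∈ S, z.2 ≠ -1) :
    (B.StaticallyBalancedOn S ↔ B.F1 = 0 ∧ B.F2 = 0) ∧
      (B.DynamicallyBalancedOn S ↔ B.LinearConditionsIV B.l1) := by
  obtain ⟨h2d, h13⟩ := id h
  have l0 := B.l1_pos
  have d0 := B.d_pos
  have hld : B.l1 ≠ B.d := fun h' => hne (h'.trans h2d.symm)
  have h3 : ¬ B.CaseIII := fun h3 => hld h3.1
  have hst := staticallyBalancedOn_iff_F_eq_zero hS hS' (fun h' => hne h'.1.1)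
    (fun h' => h3 h'.1)
    (fun ⟨_, h'⟩ => by obtain ⟨z, hz⟩ := hS'.nonempty; exact hmode z hz (h' z hz))
  refine ⟨hst, ?_⟩
  have hE : B.l1 ^ 2 - B.d ^ 2 ≠ 0 := fun h' =>
    hld ((sq_eq_sq₀ l0.le d0.le).1 (sub_eq_zero.1 h'))
  have hcl : ∀ z ∈ S, B.z3 z * (B.l1 + B.d * -z.1) = B.l1 * -z.1 + B.d := by
    intro z hz
    have hx0 : z.1 ≠ 0 := fun h' => by have := (hS hz).1; simp [h'] at this
    have := deltoid_closure' h (hS hz) (hmode z hz)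
    refine mul_left_cancel₀ hx0 ?_
    linear_combination this + (B.l1 - B.d * z.1) * deltoid_z3' h (hS hz) (hmode z hz)
  have hvel : ∀ z ∈ S, ∀ ω1 ω2 ω3, B.IsVelocity z ω1 ω2 ω3 ↔ ∃ t,
      ω1 = t * (B.l1 ^ 2 + B.d ^ 2 + 2 * B.l1 * B.d * (-z.1).re) ∧
      ω2 = t * (2 * B.l1 ^ 2 + 2 * B.l1 * B.d * (-z.1).re) ∧
      ω3 = t * (B.l1 ^ 2 - B.d ^ 2) := by
    intro z hz ω1 ω2 ω3
    have hz3 := deltoid_z3' h (hS hz) (hmode z hz)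
    have hx2 : (-z.1) ^ 2 ≠ 1 := fun h' => hmode z hz <| by
      rw [← hz3, moebius_of_sq_eq_one l0 d0 hld (hcl z hz) h']
      linear_combination -h'
    have hv := moebius_velocity_iff d0 hld l0 (Y := -z.1) (by rw [norm_neg]; exact (hS hz).1)
      (norm_z3_of_mem_configs (hS hz)) (hcl z hz) hx2 ω3 ω1 ω2
    rw [isVelocity_iff, ← h13, h2d]
    refine Iff.trans ?_ (hv.trans (exists_congr fun t => by tauto))
    rw [mul_neg, hz3]
    constructor <;> intro h' <;> linear_combination h'
  rw [dynamicallyBalancedOn_iff_of_velocity hS _ _ _ hvel, hst]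
  have hL : B.F2 = 0 → ∀ z ∈ S, B.l1 * B.angularMomentum z
      (B.l1 ^ 2 + B.d ^ 2 + 2 * B.l1 * B.d * (-z.1).re)
      (2 * B.l1 ^ 2 + 2 * B.l1 * B.d * (-z.1).re) (B.l1 ^ 2 - B.d ^ 2) =
      ((B.l1 * (B.J1 + B.m3 * B.l1 ^ 2 + B.J2) - (B.l1 ^ 2 - B.d ^ 2) * B.q3.re) *
        (B.l1 ^ 2 + B.d ^ 2) + (B.l1 * (B.J2 + B.J3) - (B.l1 ^ 2 - B.d ^ 2) * B.q3.re) *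
        (B.l1 ^ 2 - B.d ^ 2)) +
      (-(2 * B.l1 * B.d) * (B.l1 * (B.J1 + B.m3 * B.l1 ^ 2 + B.J2) -
        (B.l1 ^ 2 - B.d ^ 2) * B.q3.re)) * z.1.re +
      (4 * B.d * B.l1 ^ 3 * B.q3.im) * z.1.im +
      (-4 * B.d ^ 2 * B.l1 ^ 2 * B.q3.im) * (z.1.re * z.1.im) := by
    intro hF z hz
    obtain ⟨k1, k2⟩ := q2_re_im hF
    rw [← h13, h2d] at k1 k2
    have hz3 := deltoid_z3' h (hS hz) (hmode z hz)
    have hx := Complex.conj_mul_of_norm_one (hS hz).1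
    have hk : (B.l1 ^ 2 : ℂ) * (B.z3 z * starRingEnd ℂ z.1) - B.d ^ 2 * z.2 =
        (B.d ^ 2 - B.l1 ^ 2) - B.l1 * B.d * (z.1 - starRingEnd ℂ z.1) := by
      linear_combination (B.l1 + B.d * z.1) * starRingEnd ℂ z.1 * hcl z hz + B.d ^ 2 * hz3 +
        (B.d ^ 2 * B.z3 z * z.1 + B.d ^ 2 - B.l1 ^ 2 - B.l1 * B.d * z.1) * hx
    have hre := congrArg Complex.re hk
    have him := congrArg Complex.im hk
    rw [Complex.sub_conj] at hre him
    simp [← Complex.ofReal_pow, Complex.mul_re, Complex.mul_im] at hre him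
    rw [angularMomentum_eq (hS hz)]
    simp only [Complex.mul_re, Complex.mul_im, Complex.conj_re, Complex.conj_im, Complex.neg_re]
    linear_combination (B.d * (2 * B.l1 ^ 2 - 2 * B.l1 * B.d * z.1.re)) *
      (z.2.re * k1 - z.2.im * k2) + (2 * B.l1 ^ 2 - 2 * B.l1 * B.d * z.1.re) *
      (B.q3.re * hre - B.q3.im * him)
  have hcoef : B.F2 = 0 → ((∀ z ∈ S, B.angularMomentum z
      (B.l1 ^ 2 + B.d ^ 2 + 2 * B.l1 * B.d * (-z.1).re)
      (2 * B.l1 ^ 2 + 2 * B.l1 * B.d * (-z.1).re) (B.l1 ^ 2 - B.d ^ 2) = 0) ↔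
      B.l1 * (B.J2 + B.J3) - (B.l1 ^ 2 - B.d ^ 2) * B.q3.re = 0 ∧
      B.l1 * (B.J1 + B.m3 * B.l1 ^ 2 + B.J2) - (B.l1 ^ 2 - B.d ^ 2) * B.q3.re = 0 ∧
      B.q3.im = 0) := by
    intro hF
    constructor
    · intro h0
      obtain ⟨e0, e1, e2, -⟩ := trigPoly_coeffs_eq_zero_re_im (infinite_image_fst hS hS' h3)
        (by rintro _ ⟨z, hz, rfl⟩; exact (hS hz).1) (by
          rintro _ ⟨z, hz, rfl⟩
          rw [← hL hF z hz, h0 z hz, mul_zero])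
      have e1' := (mul_eq_zero.1 e1).resolve_left
        (neg_ne_zero.2 (mul_pos (mul_pos two_pos l0) d0).ne')
      rw [e1', zero_mul, zero_add] at e0
      exact ⟨(mul_eq_zero.1 e0).resolve_right hE, e1',
        (mul_eq_zero.1 e2).resolve_left (by positivity)⟩
    · rintro ⟨e0, e1, e2⟩ z hz
      refine mul_left_cancel₀ l0.ne' ?_
      rw [hL hF z hz, e0, e1, e2]
      ring
  have hF1 : B.F1 = 0 ↔ B.q1 = B.q3 - B.l1 * B.m3 := by
    rw [F1_eq, G1, ← h13, neg_div, div_self l0.ne']; push_cast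
    constructor <;> intro h' <;> linear_combination h'
  have hF2 : B.F2 = 0 ↔ B.q2 = -(B.d / B.l1) * B.q3 := by
    rw [F2_eq, G2, ← h13, h2d]; push_cast
    constructor <;> intro h' <;> linear_combination h'
  have hJ1 : (B.J1 : ℂ) = B.J3 - B.l1 ^ 2 * B.m3 ↔ B.J1 = B.J3 - B.l1 ^ 2 * B.m3 := by
    norm_cast
  have hJ2 : (B.J2 : ℂ) = (B.l1 ^ 2 - B.d ^ 2) / B.l1 * B.q3 - B.J3 ↔
      B.J2 = (B.l1 ^ 2 - B.d ^ 2) / B.l1 * B.q3.re - B.J3 ∧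
      (B.l1 ^ 2 - B.d ^ 2) / B.l1 * B.q3.im = 0 := by
    rw [← ofReal_eq_mul_iff]; push_cast; rfl
  rw [LinearConditionsIV, ← hF1, ← hF2, hJ1, hJ2, and_assoc]
  refine and_congr_right fun _ => and_congr_right fun hF => ?_
  rw [hcoef hF]
  have hd : B.l1 * ((B.l1 ^ 2 - B.d ^ 2) / B.l1) = B.l1 ^ 2 - B.d ^ 2 := by field_simp
  constructor
  · rintro ⟨e0, e1, e2⟩
    refine ⟨mul_left_cancel₀ l0.ne' ?_, mul_left_cancel₀ l0.ne' ?_, by rw [e2, mul_zero]⟩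
    · linear_combination e1 - e0
    · linear_combination e0 - B.q3.re * hd
  · rintro ⟨k1, k2, k3⟩
    have e0 : B.l1 * (B.J2 + B.J3) - (B.l1 ^ 2 - B.d ^ 2) * B.q3.re = 0 := by
      linear_combination B.l1 * k2 + B.q3.re * hd
    refine ⟨e0, by linear_combination e0 + B.l1 * k1, (mul_eq_zero.1 k3).resolve_left ?_⟩
    exact div_ne_zero hE l0.ne'

end FourBar

/-! ### The modes in which the mechanism cannot be dynamically balanced -/

namespace FourBar

variable {B : FourBar} {S : Set (ℂ × ℂ)}

/-- In the parallelogram mode the coupler moves in translation, and the constant term of the angular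
momentum is positive. -/
theorem not_dynamicallyBalancedOn_parallelogram (h : B.CaseII) (hS : S ⊆ B.configs)
    (hS' : S.Infinite) (hmode : ∀ z ∈ S, z.1 = z.2) : ¬ B.DynamicallyBalancedOn S := by
  rintro ⟨-, hdyn⟩
  obtain ⟨h12, h3d⟩ := h
  have hT : (Prod.fst '' S).Infinite := hS'.image fun z hz w hw hzw =>
    Prod.ext hzw (by rw [← hmode z hz, ← hmode w hw]; exact hzw)
  obtain ⟨h0, -, -⟩ := trigPoly_coeffs_eq_zero hT
    (by rintro _ ⟨z, hz, rfl⟩; exact (hS hz).1)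
    (a := B.J1 + B.m3 * B.l1 ^ 2 + B.J2) (b := B.d * B.q2 + B.l1 * starRingEnd ℂ B.q3)
    (c := 0) (by
      rintro _ ⟨z, hz, rfl⟩
      have hz3 : B.z3 z = 1 := by
        have e := B.l3_mul_z3 z
        rw [h3d, h12, hmode z hz] at e
        refine mul_left_cancel₀ B.ofReal_lengths_ne_zero.2.2.2 ?_
        linear_combination e
      have hL := hdyn z hz 1 1 0 (by
        rw [isVelocity_iff, ← h12, hmode z hz]; simp)
      rw [angularMomentum_eq (hS hz), hz3, ← hmode z hz] at hL
      simp [Complex.mul_re] at hL ⊢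
      linear_combination hL)
  have := B.J1_pos
  have := B.J2_pos
  have := mul_pos B.m3_pos (pow_pos B.l1_pos 2)
  linarith

/-- In the deltoid mode `z1 = 1` the links `2` and `3` turn together about a fixed point. -/
theorem not_dynamicallyBalancedOn_deltoid (h : B.CaseIII) (hS : S ⊆ B.configs)
    (hS' : S.Infinite) (hmode : ∀ z ∈ S, z.1 = 1) : ¬ B.DynamicallyBalancedOn S := by
  rintro ⟨-, hdyn⟩
  obtain ⟨h1d, h23⟩ := h
  have hT : (Prod.snd '' S).Infinite := hS'.image fun z hz w hw hzw =>
    Prod.ext (by rw [hmode z hz, hmode w hw]) hzw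
  obtain ⟨h0, -, -⟩ := trigPoly_coeffs_eq_zero hT
    (by rintro _ ⟨z, hz, rfl⟩; exact (hS hz).2.1)
    (a := B.J2 + B.J3) (b := B.d * (B.q2 + B.q3)) (c := 0) (by
      rintro _ ⟨z, hz, rfl⟩
      have hz3 : B.z3 z = z.2 := by
        have e := B.l3_mul_z3 z
        rw [← h23, h1d, hmode z hz] at e
        refine mul_left_cancel₀ B.ofReal_lengths_ne_zero.2.1 ?_
        linear_combination e
      have hL := hdyn z hz 0 1 1 (by rw [isVelocity_iff, hz3, h23]; simp)
      rw [angularMomentum_eq (hS hz), hz3, hmode z hz, h1d] at hL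
      simp [Complex.mul_re] at hL ⊢
      linear_combination hL)
  have := B.J2_pos
  have := B.J3_pos
  linarith

theorem normSq_q3_lt (B : FourBar) : B.q3.re ^ 2 + B.q3.im ^ 2 < B.m3 * B.J3 := by
  have := Complex.sq_add_sq_of_norm_one B.norm_p3
  rw [q3, ← Complex.ofReal_mul, Complex.re_ofReal_mul, Complex.im_ofReal_mul, J3]
  nlinarith [mul_pos B.m3_pos B.I3_pos]

/-- In the deltoid mode `z2 = -1` the links `1` and `3` turn together about the point `0`, and the
angular momentum is their common angular velocity times their moment of inertia about `0`. -/
theorem not_dynamicallyBalancedOn_deltoid' (h : B.CaseIV) (hS : S ⊆ B.configs)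
    (hS' : S.Infinite) (hmode : ∀ z ∈ S, z.2 = -1) : ¬ B.DynamicallyBalancedOn S := by
  rintro ⟨-, hdyn⟩
  obtain ⟨h2d, h13⟩ := h
  obtain ⟨z, hz⟩ := hS'.nonempty
  have hz3 : B.z3 z = -z.1 := by
    have e := B.l3_mul_z3 z
    rw [← h13, h2d, hmode z hz] at e
    refine mul_left_cancel₀ B.ofReal_lengths_ne_zero.1 ?_
    linear_combination e
  have hL := hdyn z hz 1 0 1 (by rw [isVelocity_iff, hz3, h13]; simp)
  have hx := Complex.conj_mul_of_norm_one (hS hz).1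
  rw [angularMomentum_eq (hS hz), hz3, show B.q3 * -z.1 * starRingEnd ℂ z.1 = -B.q3 by
    linear_combination -B.q3 * hx, Complex.neg_re] at hL
  have h1 := mul_pos B.m3_pos B.J1_pos
  have h3 := B.normSq_q3_lt
  have hL' : B.m3 * B.J1 + B.m3 ^ 2 * B.l1 ^ 2 + B.m3 * B.J3 - 2 * B.m3 * B.l1 * B.q3.re = 0 := by
    linear_combination B.m3 * hL
  nlinarith [sq_nonneg (B.q3.re - B.m3 * B.l1), sq_nonneg B.q3.im]

theorem DynamicallyBalancedOn.mono {T : Set (ℂ × ℂ)} (h : B.DynamicallyBalancedOn S) (hT : T ⊆ S) :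
    B.DynamicallyBalancedOn T :=
  ⟨h.1.imp fun _ hc z hz => hc z (hT hz), fun z hz => h.2 z (hT hz)⟩

theorem CaseV.cases (h : B.CaseV) {z : ℂ × ℂ} (hz : z ∈ B.configs) :
    z.1 = z.2 ∨ z.1 = 1 ∨ z.2 = -1 := by
  obtain ⟨h1, h2, h3⟩ := h
  have e := quadratic_of_mem_configs hz
  have hd := B.ofReal_lengths_ne_zero.2.2.2
  rw [h1, h2, h3] at e
  have e' : (z.1 - z.2) * ((z.1 - 1) * (z.2 + 1)) = 0 := by
    refine mul_left_cancel₀ (pow_ne_zero 2 hd) ?_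
    linear_combination -e
  rcases mul_eq_zero.1 e' with h | h
  · exact Or.inl (sub_eq_zero.1 h)
  rcases mul_eq_zero.1 h with h | h
  · exact Or.inr (Or.inl (sub_eq_zero.1 h))
  · exact Or.inr (Or.inr (eq_neg_of_add_eq_zero_left h))

/-- With all lengths equal, an infinite set of configurations has infinitely many elements in one of
the three degenerate modes. -/
theorem not_dynamicallyBalancedOn_of_caseV (h : B.CaseV) (hS : S ⊆ B.configs) (hS' : S.Infinite) :
    ¬ B.DynamicallyBalancedOn S := by
  intro hB
  have hun : S = {z ∈ S | z.1 = z.2} ∪ ({z ∈ S | z.1 = 1} ∪ {z ∈ S | z.2 = -1}) := by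
    ext z
    constructor
    · intro hz
      rcases h.cases (hS hz) with h' | h' | h'
      · exact Or.inl ⟨hz, h'⟩
      · exact Or.inr (Or.inl ⟨hz, h'⟩)
      · exact Or.inr (Or.inr ⟨hz, h'⟩)
    · rintro (hz | hz | hz) <;> exact hz.1
  rw [hun, Set.infinite_union, Set.infinite_union] at hS'
  obtain ⟨h1, h2, h3⟩ := h
  rcases hS' with hi | hi | hi
  · exact not_dynamicallyBalancedOn_parallelogram ⟨h1, h3⟩ (fun z hz => hS hz.1) hi
      (fun z hz => hz.2) (hB.mono fun z hz => hz.1)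
  · exact not_dynamicallyBalancedOn_deltoid ⟨h1.trans (h2.trans h3), h2⟩ (fun z hz => hS hz.1) hi
      (fun z hz => hz.2) (hB.mono fun z hz => hz.1)
  · exact not_dynamicallyBalancedOn_deltoid' ⟨h2.trans h3, h1.trans h2⟩ (fun z hz => hS hz.1) hi
      (fun z hz => hz.2) (hB.mono fun z hz => hz.1)

end FourBar

/-! ### Lengths for which dynamic balancing is possible -/

theorem sqrt_two_mul_lt_iff {l d : ℝ} (hl : 0 < l) (hd : 0 < d) :
    √2 * l < d ↔ 2 * l ^ 2 < d ^ 2 := by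
  rw [← sq_lt_sq₀ (by positivity) hd.le, mul_pow, Real.sq_sqrt (by norm_num)]

theorem infinite_unit_sq_ne_one : {Y : ℂ | ‖Y‖ = 1 ∧ Y ^ 2 ≠ 1}.Infinite := by
  refine Set.Infinite.mono ?_ ((Set.Ioo_infinite (show (-1 : ℝ) < 1 by norm_num)).image
    (f := fun t : ℝ => (⟨t, √(1 - t ^ 2)⟩ : ℂ)) fun s _ t _ hst => congrArg Complex.re hst)
  rintro _ ⟨t, ht, rfl⟩
  have ht1 : 0 < 1 - t ^ 2 := by nlinarith [ht.1, ht.2]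
  constructor
  · rw [← pow_eq_one_iff_of_nonneg (norm_nonneg _) two_ne_zero, ← Complex.normSq_eq_norm_sq,
      Complex.normSq_mk, Real.mul_self_sqrt ht1.le]
    ring
  · intro h
    have him : √(1 - t ^ 2) = 0 := by
      rcases eq_or_eq_neg_of_sq_eq_sq _ _ (h.trans (one_pow 2).symm) with h | h
      · simpa using congrArg Complex.im h
      · simpa using congrArg Complex.im h
    exact (Real.sqrt_pos.2 ht1).ne' him

theorem exists_moebius {l d : ℝ} (hl : 0 < l) (hd : 0 < d) (hld : l ≠ d) {Y : ℂ} (hY : ‖Y‖ = 1) :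
    ∃ M : ℂ, ‖M‖ = 1 ∧ M * (l + d * Y) = l * Y + d := by
  have hY' := Complex.conj_mul_of_norm_one hY
  have h0 : (l + d * Y : ℂ) ≠ 0 := by
    intro h
    have h1 := congrArg norm (eq_neg_of_add_eq_zero_left h)
    rw [norm_neg, norm_mul, hY, mul_one, Complex.norm_real, Complex.norm_real, Real.norm_of_nonneg
      hl.le, Real.norm_of_nonneg hd.le] at h1
    exact hld h1
  refine ⟨(l * Y + d) / (l + d * Y), ?_, div_mul_cancel₀ _ h0⟩
  have h1 : (l * Y + d : ℂ) = Y * starRingEnd ℂ (l + d * Y) := by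
    simp only [map_add, map_mul, Complex.conj_ofReal]
    linear_combination -d * hY'
  rw [norm_div, h1, norm_mul, hY, one_mul, Complex.norm_conj, div_self (norm_ne_zero_iff.2 h0)]

namespace FourBar

variable {B : FourBar}

/-- The converse of `FourBar.quadratic_of_mem_configs`. -/
theorem mem_configs_of_quadratic {z : ℂ × ℂ} (h1 : ‖z.1‖ = 1) (h2 : ‖z.2‖ = 1)
    (h : (B.l2 * (B.d * z.1 - B.l1) : ℂ) * z.2 ^ 2 +
      ((B.l1 ^ 2 + B.l2 ^ 2 + B.d ^ 2 - B.l3 ^ 2) * z.1 - B.l1 * B.d * (z.1 ^ 2 + 1)) * z.2 +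
      B.l2 * z.1 * (B.d - B.l1 * z.1) = 0) : z ∈ B.configs := by
  refine ⟨h1, h2, ?_⟩
  have hx : z.1 ≠ 0 := fun h => by simp [h] at h1
  have hy : z.2 ≠ 0 := fun h => by simp [h] at h2
  have hc := B.ofReal_lengths_ne_zero.2.2.1
  simp only [G, G1, G2, G3]
  push_cast
  field_simp
  linear_combination h

theorem infinite_antiparallelogram (h : B.CaseII) (hne : B.l1 ≠ B.d) :
    (B.configs ∩ {z | z.1 ≠ z.2}).Infinite := by
  refine Set.Infinite.of_image Prod.snd (infinite_unit_sq_ne_one.mono ?_)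
  rintro Y ⟨hY, hY2⟩
  obtain ⟨M, hM, hMY⟩ := exists_moebius B.l1_pos B.d_pos hne hY
  refine ⟨(M, Y), ⟨mem_configs_of_quadratic hM hY ?_, ?_⟩, rfl⟩
  · rw [h.2, ← h.1]
    linear_combination -B.l1 * (M - Y) * hMY
  · rintro (rfl : M = Y)
    exact hY2 (mul_left_cancel₀ B.ofReal_lengths_ne_zero.2.2.2 (by linear_combination hMY))

theorem infinite_deltoid (h : B.CaseIII) (hne : B.l2 ≠ B.d) :
    (B.configs ∩ {z | z.1 ≠ 1}).Infinite := by
  refine Set.Infinite.of_image Prod.snd (infinite_unit_sq_ne_one.mono ?_)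
  rintro Y ⟨hY, hY2⟩
  obtain ⟨M, hM, hMY⟩ := exists_moebius B.l2_pos B.d_pos hne hY
  refine ⟨(M * Y, Y), ⟨mem_configs_of_quadratic (by rw [norm_mul, hM, hY, one_mul]) hY ?_, ?_⟩, rfl⟩
  · rw [h.1, ← h.2]
    linear_combination -B.d * Y * (M * Y - 1) * hMY
  · intro (hMY1 : M * Y = 1)
    exact hY2 (mul_left_cancel₀ B.ofReal_lengths_ne_zero.2.1
      (by linear_combination (B.l2 + B.d * Y) * hMY1 - Y * hMY))

theorem infinite_deltoid' (h : B.CaseIV) (hne : B.l1 ≠ B.d) :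
    (B.configs ∩ {z | z.2 ≠ -1}).Infinite := by
  refine Set.Infinite.of_image (fun z => -z.1) (infinite_unit_sq_ne_one.mono ?_)
  rintro Y ⟨hY, hY2⟩
  obtain ⟨M, hM, hMY⟩ := exists_moebius B.l1_pos B.d_pos hne hY
  refine ⟨(-Y, -(M * Y)), ⟨mem_configs_of_quadratic (by rw [norm_neg, hY])
    (by rw [norm_neg, norm_mul, hM, hY, one_mul]) ?_, ?_⟩, neg_neg Y⟩
  · rw [h.1, ← h.2]
    linear_combination -B.d * Y * (M * Y - 1) * hMY
  · intro (hMY1 : -(M * Y) = -1)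
    exact hY2 (mul_left_cancel₀ B.ofReal_lengths_ne_zero.1
      (by linear_combination -(B.l1 + B.d * Y) * hMY1 - Y * hMY))

/-- Mass, centre of mass and moment of inertia of a link can be recovered from `m`, `q = m r p` and
`J = I + m r ^ 2`, here for real `q`, provided that `q ^ 2 < m J`. -/
theorem exists_link {m q J : ℝ} (hm : 0 < m) (h : q ^ 2 < m * J) :
    ∃ (r : ℝ) (p : ℂ) (I : ℝ), 0 ≤ r ∧ ‖p‖ = 1 ∧ 0 < I ∧ (m * r * p : ℂ) = q ∧
      I + m * r ^ 2 = J := by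
  have hI : 0 < J - m * (|q| / m) ^ 2 := by
    rw [div_pow, sq_abs, sub_pos]
    have : m * (q ^ 2 / m ^ 2) = q ^ 2 / m := by field_simp
    rw [this, div_lt_iff₀ hm]
    linarith
  have hm' : (m : ℂ) ≠ 0 := by exact_mod_cast hm.ne'
  rcases le_total 0 q with hq | hq
  · refine ⟨|q| / m, 1, J - m * (|q| / m) ^ 2, by positivity, by simp, hI, ?_, by ring⟩
    rw [abs_of_nonneg hq]; push_cast; field_simp
  · refine ⟨|q| / m, -1, J - m * (|q| / m) ^ 2, by positivity, by simp, hI, ?_, by ring⟩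
    rw [abs_of_nonpos hq]; push_cast; field_simp

/-- The masses of the links at the base are free, so `q1` and `q2` impose no restriction on `J1` and
`J2` besides positivity. -/
theorem exists_fourBar {l1 l2 l3 d m3 q1 q2 q3 J1 J2 J3 : ℝ} (hl1 : 0 < l1) (hl2 : 0 < l2)
    (hl3 : 0 < l3) (hd : 0 < d) (hm3 : 0 < m3) (hJ1 : 0 < J1) (hJ2 : 0 < J2)
    (hJ3 : q3 ^ 2 < m3 * J3) :
    ∃ B : FourBar, B.l1 = l1 ∧ B.l2 = l2 ∧ B.l3 = l3 ∧ B.d = d ∧ B.m3 = m3 ∧ B.q1 = q1 ∧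
      B.q2 = q2 ∧ B.q3 = q3 ∧ B.J1 = J1 ∧ B.J2 = J2 ∧ B.J3 = J3 := by
  have hm : ∀ {q J : ℝ}, 0 < J → q ^ 2 < (q ^ 2 / J + 1) * J := by
    intro q J hJ
    rw [add_mul, div_mul_cancel₀ _ hJ.ne']
    linarith
  have h1 : 0 < q1 ^ 2 / J1 + 1 := by positivity
  have h2 : 0 < q2 ^ 2 / J2 + 1 := by positivity
  obtain ⟨r1, p1, I1, hr1, hp1, hI1, e1, f1⟩ := exists_link h1 (hm hJ1)
  obtain ⟨r2, p2, I2, hr2, hp2, hI2, e2, f2⟩ := exists_link h2 (hm hJ2)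
  obtain ⟨r3, p3, I3, hr3, hp3, hI3, e3, f3⟩ := exists_link hm3 hJ3
  exact ⟨⟨l1, l2, l3, d, _, _, m3, r1, r2, r3, p1, p2, p3, I1, I2, I3, hl1, hl2, hl3, hd, h1, h2,
    hm3, hr1, hr2, hr3, hp1, hp2, hp3, hI1, hI2, hI3⟩, rfl, rfl, rfl, rfl, rfl, e1, e2, e3, f1, f2,
    f3⟩

end FourBar

open FourBar

theorem dynamicBalancingPossible_antiparallelogram_iff {l d : ℝ} (hl : 0 < l) (hd : 0 < d) :
    DynamicBalancingPossible l l d d {z | z.1 ≠ z.2} ↔ √2 * l < d := by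
  rw [sqrt_two_mul_lt_iff hl hd]
  constructor
  · rintro ⟨B, h1, h2, h3, h4, S, hS, hS', hB⟩
    have hII : B.CaseII := ⟨h1.trans h2.symm, h3.trans h4.symm⟩
    have hSc : S ⊆ B.configs := fun z hz => (hS hz).1
    have hld : l ≠ d := fun e =>
      not_dynamicallyBalancedOn_of_caseV ⟨hII.1, by rw [h2, h3, e], hII.2⟩ hSc hS' hB
    obtain ⟨-, -, hJ1, hJ2⟩ := (dynamicallyBalancedOn_iff_of_caseII hII (by rwa [h1, h3])
      hSc hS' fun z hz => (hS hz).2).2.1 hB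
    have hJ1' : B.J1 = (B.d ^ 2 + B.l1 ^ 2) / B.d * B.q3.re - (B.J3 + B.l1 ^ 2 * B.m3) :=
      (ofReal_eq_mul_iff.1 (by push_cast; rw [hJ1]; ring)).1
    have hJ2' : B.J2 = (B.d ^ 2 - B.l1 ^ 2) / B.d * B.q3.re - B.J3 :=
      (ofReal_eq_mul_iff.1 (by push_cast; rw [hJ2])).1
    have p1 := B.J1_pos
    have p2 := B.J2_pos
    have p3 := B.J3_pos
    have m0 := B.m3_pos
    have hq := B.normSq_q3_lt
    rw [h1, h4] at hJ1' hJ2'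
    set q := B.q3.re
    set m := B.m3
    have k1 : d * (B.J3 + l ^ 2 * m) < (d ^ 2 + l ^ 2) * q := by
      have : d * B.J1 = (d ^ 2 + l ^ 2) * q - d * (B.J3 + l ^ 2 * m) := by
        rw [hJ1']; field_simp
      linarith [mul_pos hd p1]
    have k2 : d * B.J3 < (d ^ 2 - l ^ 2) * q := by
      have : d * B.J2 = (d ^ 2 - l ^ 2) * q - d * B.J3 := by
        rw [hJ2']; field_simp
      linarith [mul_pos hd p2]
    have k3 : q ^ 2 < m * B.J3 := by linarith [sq_nonneg B.q3.im]
    have q0 : 0 < q := by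
      have : 0 < (d ^ 2 + l ^ 2) * q := lt_trans (by positivity) k1
      exact pos_of_mul_pos_right this (by positivity)
    have k4 : d * q < m * (d ^ 2 - l ^ 2) := by
      refine lt_of_mul_lt_mul_right ?_ q0.le
      nlinarith [mul_lt_mul_of_pos_left k3 hd, mul_lt_mul_of_pos_left k2 m0]
    -- `q / m` lies between the zeros `l ^ 2 / d` and `d` of a quadratic polynomial.
    have k5 : (q * d - l ^ 2 * m) * (q - d * m) < 0 := by
      nlinarith [mul_lt_mul_of_pos_left k3 hd, mul_lt_mul_of_pos_left k1 m0]
    have k6 : q - d * m < 0 := by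
      refine neg_of_mul_neg_right (a := d) ?_ hd.le
      nlinarith [mul_pos m0 (pow_pos hl 2)]
    have k7 : 0 < q * d - l ^ 2 * m := pos_of_mul_neg_left k5 k6.le
    have k8 : 0 < m * (d ^ 2 - 2 * l ^ 2) := by linarith
    linarith [pos_of_mul_pos_right k8 m0.le]
  · intro h
    have hld : l ≠ d := by rintro rfl; nlinarith [pow_pos hl 2]
    obtain ⟨B, h1, h2, h3, h4, e0, e1, e2, e3, f1, f2, f3⟩ := exists_fourBar (m3 := 1)
      (q1 := -l / 2) (q2 := -l / 2) (q3 := d / 2) (J1 := (d ^ 2 - 2 * l ^ 2) / 8)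
      (J2 := (d ^ 2 - 2 * l ^ 2) / 8) (J3 := (3 * d ^ 2 - 2 * l ^ 2) / 8) hl hl hd hd one_pos
      (by linarith) (by linarith) (by linarith)
    have hII : B.CaseII := ⟨h1.trans h2.symm, h3.trans h4.symm⟩
    refine ⟨B, h1, h2, h3, h4, B.configs ∩ {z | z.1 ≠ z.2}, subset_rfl,
      infinite_antiparallelogram hII (by rwa [h1, h4]), ?_⟩
    rw [(dynamicallyBalancedOn_iff_of_caseII hII (by rwa [h1, h3]) (fun z hz => hz.1)
      (infinite_antiparallelogram hII (by rwa [h1, h4])) fun z hz => hz.2).2, LinearConditionsII,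
      h1, h4, e0, e1, e2, e3, f1, f2, f3]
    have hd' : (d : ℂ) ≠ 0 := by exact_mod_cast hd.ne'
    push_cast
    refine ⟨?_, ?_, ?_, ?_⟩ <;> field_simp <;> ring

theorem dynamicBalancingPossible_deltoid_iff {l d : ℝ} (hl : 0 < l) (hd : 0 < d) :
    DynamicBalancingPossible d l l d {z | z.1 ≠ 1} ↔ √2 * l < d := by
  rw [sqrt_two_mul_lt_iff hl hd]
  constructor
  · rintro ⟨B, h1, h2, h3, h4, S, hS, hS', hB⟩
    have hIII : B.CaseIII := ⟨h1.trans h4.symm, h2.trans h3.symm⟩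
    have hSc : S ⊆ B.configs := fun z hz => (hS hz).1
    have hld : l ≠ d := fun e =>
      not_dynamicallyBalancedOn_of_caseV ⟨by rw [h1, h2, e], hIII.2, by rw [h3, h4, e]⟩ hSc hS' hB
    obtain ⟨-, -, hJ1, hJ2⟩ := (dynamicallyBalancedOn_iff_of_caseIII hIII
      (by rw [h1, h2]; exact hld.symm) hSc hS' fun z hz => (hS hz).2).2.1 hB
    have hJ1' : B.J1 = (B.d ^ 2 + B.l2 ^ 2) / B.l2 * B.q3.re - (B.J3 + B.d ^ 2 * B.m3) :=
      (ofReal_eq_mul_iff.1 (by push_cast; rw [hJ1]; ring)).1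
    have hJ2' : B.J2 = (-2 * B.l2) * B.q3.re - -B.J3 :=
      (ofReal_eq_mul_iff.1 (by push_cast; rw [hJ2]; ring)).1
    have p1 := B.J1_pos
    have p2 := B.J2_pos
    have p3 := B.J3_pos
    have m0 := B.m3_pos
    have hq := B.normSq_q3_lt
    rw [h2] at hJ2'
    rw [h2, h4] at hJ1'
    set q := B.q3.re
    set m := B.m3
    have k1 : l * (B.J3 + d ^ 2 * m) < (d ^ 2 + l ^ 2) * q := by
      have : l * B.J1 = (d ^ 2 + l ^ 2) * q - l * (B.J3 + d ^ 2 * m) := by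
        rw [hJ1']; field_simp
      linarith [mul_pos hl p1]
    have k2 : 2 * l ^ 2 * q < l * B.J3 := by nlinarith
    have k3 : q ^ 2 < m * B.J3 := by linarith [sq_nonneg B.q3.im]
    have q0 : 0 < q := by
      have : 0 < (d ^ 2 + l ^ 2) * q := lt_trans (by positivity) k1
      exact pos_of_mul_pos_right this (by positivity)
    have k4 : l * d ^ 2 * m < (d ^ 2 - l ^ 2) * q := by linarith
    -- `q / m` lies between the zeros `l` and `d ^ 2 / l` of a quadratic polynomial.
    have k5 : (q * l - d ^ 2 * m) * (q - l * m) < 0 := by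
      nlinarith [mul_lt_mul_of_pos_left k3 hl, mul_lt_mul_of_pos_left k1 m0]
    have k6 : 0 < q - l * m := by
      refine pos_of_mul_pos_right (a := d ^ 2) ?_ (sq_nonneg d)
      nlinarith [mul_pos q0 (pow_pos hl 2)]
    have k7 : q * l - d ^ 2 * m < 0 := neg_of_mul_neg_left k5 k6.le
    have dl : 0 < d ^ 2 - l ^ 2 :=
      pos_of_mul_pos_left (lt_trans (by positivity) k4) q0.le
    have k8 : 0 < (d ^ 2 * m) * (d ^ 2 - 2 * l ^ 2) := by
      nlinarith [mul_lt_mul_of_pos_left k4 hl, mul_pos dl (neg_pos.2 k7)]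
    linarith [pos_of_mul_pos_right k8 (by positivity)]
  · intro h
    have hld : l ≠ d := by rintro rfl; nlinarith [pow_pos hl 2]
    have hdl : 0 < d ^ 2 - l ^ 2 := by nlinarith [pow_pos hl 2]
    obtain ⟨τ, hτ1, hτ2⟩ : ∃ τ, l * d ^ 2 / (d ^ 2 - l ^ 2) < τ ∧ τ < d ^ 2 / l := by
      refine exists_between ?_
      rw [div_lt_div_iff₀ hdl hl]
      nlinarith [pow_pos hd 2]
    rw [div_lt_iff₀ hdl] at hτ1
    rw [lt_div_iff₀ hl] at hτ2
    have hτ0 : 0 < τ := pos_of_mul_pos_left (lt_trans (by positivity) hτ1) hdl.le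
    have hτl : l < τ := by nlinarith [pow_pos hd 2, mul_pos hτ0 (pow_pos hl 2)]
    obtain ⟨j, hj1, hj2⟩ : ∃ j, max (τ ^ 2) (2 * l * τ) < j ∧
        j < (d ^ 2 + l ^ 2) / l * τ - d ^ 2 := by
      refine exists_between (max_lt ?_ ?_)
      · have : (d ^ 2 + l ^ 2) / l * τ - d ^ 2 - τ ^ 2 = (d ^ 2 - τ * l) * (τ - l) / l := by
          field_simp; ring
        have : 0 < (d ^ 2 - τ * l) * (τ - l) / l :=
          div_pos (mul_pos (by linarith) (by linarith)) hl
        linarith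
      · have : (d ^ 2 + l ^ 2) / l * τ - d ^ 2 - 2 * l * τ =
            (τ * (d ^ 2 - l ^ 2) - l * d ^ 2) / l := by
          field_simp; ring
        have : 0 < (τ * (d ^ 2 - l ^ 2) - l * d ^ 2) / l := div_pos (by linarith) hl
        linarith
    obtain ⟨hj3, hj4⟩ := max_lt_iff.1 hj1
    obtain ⟨B, h1, h2, h3, h4, e0, e1, e2, e3, f1, f2, f3⟩ := exists_fourBar (m3 := 1)
      (q1 := d / l * τ - d) (q2 := -τ) (q3 := τ) (J1 := (d ^ 2 + l ^ 2) / l * τ - j - d ^ 2)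
      (J2 := j - 2 * l * τ) (J3 := j) hd hl hl hd one_pos
      (by linarith) (by linarith) (by linarith)
    have hIII : B.CaseIII := ⟨h1.trans h4.symm, h2.trans h3.symm⟩
    have hinf := infinite_deltoid hIII (by rwa [h2, h4])
    refine ⟨B, h1, h2, h3, h4, B.configs ∩ {z | z.1 ≠ 1}, subset_rfl, hinf, ?_⟩
    rw [(dynamicallyBalancedOn_iff_of_caseIII hIII (by rw [h1, h2]; exact hld.symm)
      (fun z hz => hz.1) hinf fun z hz => hz.2).2, LinearConditionsIII,
      h2, h4, e0, e1, e2, e3, f1, f2, f3]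
    push_cast
    exact ⟨by ring, by ring, by ring, by ring⟩

theorem dynamicBalancingPossible_deltoid'_iff {l d : ℝ} (hl : 0 < l) (hd : 0 < d) :
    DynamicBalancingPossible l d l d {z | z.2 ≠ -1} ↔ √2 * l < d := by
  rw [sqrt_two_mul_lt_iff hl hd]
  constructor
  · rintro ⟨B, h1, h2, h3, h4, S, hS, hS', hB⟩
    have hIV : B.CaseIV := ⟨h2.trans h4.symm, h1.trans h3.symm⟩
    have hSc : S ⊆ B.configs := fun z hz => (hS hz).1
    have hld : l ≠ d := fun e =>
      not_dynamicallyBalancedOn_of_caseV ⟨by rw [h1, h2, e], by rw [h2, h3, e], by rw [h3, h4, e]⟩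
        hSc hS' hB
    obtain ⟨-, -, hJ1, hJ2⟩ := (dynamicallyBalancedOn_iff_of_caseIV hIV
      (by rwa [h1, h2]) hSc hS' fun z hz => (hS hz).2).2.1 hB
    have hJ1' : B.J1 = B.J3 - B.l1 ^ 2 * B.m3 := by exact_mod_cast hJ1
    have hJ2' : B.J2 = (B.l1 ^ 2 - B.d ^ 2) / B.l1 * B.q3.re - B.J3 :=
      (ofReal_eq_mul_iff.1 (by push_cast; rw [hJ2])).1
    have p1 := B.J1_pos
    have p2 := B.J2_pos
    have p3 := B.J3_pos
    have m0 := B.m3_pos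
    have hq := B.normSq_q3_lt
    rw [h1] at hJ1'
    rw [h1, h4] at hJ2'
    set q := B.q3.re
    set m := B.m3
    set e := l ^ 2 - d ^ 2 with he
    have k2 : l * B.J3 < e * q := by
      have : l * B.J2 = e * q - l * B.J3 := by
        rw [hJ2']; field_simp
      linarith [mul_pos hl p2]
    have k1 : l ^ 3 * m < e * q := by nlinarith [mul_pos hl p1]
    have k3 : q ^ 2 < m * B.J3 := by linarith [sq_nonneg B.q3.im]
    have k0 : 0 < e * q := lt_trans (by positivity) k1
    have k4 : l * q ^ 2 < m * (e * q) := by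
      nlinarith [mul_lt_mul_of_pos_left k3 hl, mul_lt_mul_of_pos_left k2 m0]
    have e0 : e ≠ 0 := by rintro h; simp [h] at k0
    have k5 : l * (e * q) < m * e ^ 2 := by
      refine lt_of_mul_lt_mul_right ?_ k0.le
      nlinarith [mul_lt_mul_of_pos_left k4 (pow_pos (abs_pos.2 e0) 2), sq_abs e]
    have k6 : (l ^ 2) ^ 2 < e ^ 2 := by
      refine lt_of_mul_lt_mul_left ?_ m0.le
      nlinarith [mul_lt_mul_of_pos_left k1 hl]
    -- As `e < l ^ 2`, the number `e` must be negative.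
    have k7 : 0 < (e + l ^ 2) * (e - l ^ 2) := by linarith
    have k8 : e - l ^ 2 < 0 := by linarith [pow_pos hd 2]
    linarith [neg_of_mul_pos_left k7 k8.le]
  · intro h
    have hld : l ≠ d := by rintro rfl; nlinarith [pow_pos hl 2]
    have hdl : 0 < d ^ 2 - l ^ 2 := by nlinarith [pow_pos hl 2]
    obtain ⟨σ, hσ1, hσ2⟩ : ∃ σ, l ^ 3 / (d ^ 2 - l ^ 2) < σ ∧ σ < (d ^ 2 - l ^ 2) / l := by
      refine exists_between ?_
      rw [div_lt_div_iff₀ hdl hl]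
      nlinarith [pow_pos hl 2]
    rw [div_lt_iff₀ hdl] at hσ1
    rw [lt_div_iff₀ hl] at hσ2
    have hσ0 : 0 < σ := pos_of_mul_pos_left (lt_trans (by positivity) hσ1) hdl.le
    obtain ⟨j, hj1, hj2⟩ : ∃ j, max (σ ^ 2) (l ^ 2) < j ∧ j < (d ^ 2 - l ^ 2) / l * σ := by
      refine exists_between (max_lt ?_ ?_)
      · rw [div_mul_eq_mul_div, lt_div_iff₀ hl]
        nlinarith
      · rw [div_mul_eq_mul_div, lt_div_iff₀ hl]
        linarith
    obtain ⟨hj3, hj4⟩ := max_lt_iff.1 hj1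
    obtain ⟨B, h1, h2, h3, h4, e0, e1, e2, e3, f1, f2, f3⟩ := exists_fourBar (m3 := 1)
      (q1 := -σ - l) (q2 := d / l * σ) (q3 := -σ) (J1 := j - l ^ 2)
      (J2 := (d ^ 2 - l ^ 2) / l * σ - j) (J3 := j) hl hd hl hd one_pos
      (by linarith) (by linarith) (by linarith)
    have hIV : B.CaseIV := ⟨h2.trans h4.symm, h1.trans h3.symm⟩
    have hinf := infinite_deltoid' hIV (by rwa [h1, h4])
    refine ⟨B, h1, h2, h3, h4, B.configs ∩ {z | z.2 ≠ -1}, subset_rfl, hinf, ?_⟩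
    rw [(dynamicallyBalancedOn_iff_of_caseIV hIV (by rwa [h1, h2])
      (fun z hz => hz.1) hinf fun z hz => hz.2).2, LinearConditionsIV,
      h1, h4, e0, e1, e2, e3, f1, f2, f3]
    push_cast
    exact ⟨by ring, by ring, by ring, by ring⟩

theorem mainTheorem1 :
    -- the loop-closure polynomial is irreducible exactly when no special length relation holds
    (∀ B : FourBar, Irreducible B.loopPoly ↔ ¬ B.CaseII ∧ ¬ B.CaseIII ∧ ¬ B.CaseIV) ∧
    -- irreducible case
    (∀ B : FourBar, Irreducible B.loopPoly →
      ∀ S : Set (ℂ × ℂ), S ⊆ B.configs → S.Infinite →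
        (B.StaticallyBalancedOn S ↔ B.F1 = 0 ∧ B.F2 = 0) ∧ ¬ B.DynamicallyBalancedOn S) ∧
    -- case II, mode A
    (∀ B : FourBar, B.CaseII → B.l1 ≠ B.l3 →
      ∀ S : Set (ℂ × ℂ), S ⊆ B.configs ∩ {z | z.1 ≠ z.2} → S.Infinite →
        (B.StaticallyBalancedOn S ↔ B.F1 = 0 ∧ B.F2 = 0) ∧
        (B.DynamicallyBalancedOn S ↔ B.LinearConditionsII B.l1)) ∧
    (∀ l d : ℝ, 0 < l → 0 < d →
      (DynamicBalancingPossible l l d d {z | z.1 ≠ z.2} ↔ √2 * l < d)) ∧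
    -- case II, mode B
    (∀ B : FourBar, B.CaseII →
      ∀ S : Set (ℂ × ℂ), S ⊆ B.configs ∩ {z | z.1 = z.2} → S.Infinite →
        (B.StaticallyBalancedOn S ↔ B.F1 + B.F2 = 0) ∧ ¬ B.DynamicallyBalancedOn S) ∧
    -- case III, mode A
    (∀ B : FourBar, B.CaseIII → B.l1 ≠ B.l2 →
      ∀ S : Set (ℂ × ℂ), S ⊆ B.configs ∩ {z | z.1 ≠ 1} → S.Infinite →
        (B.StaticallyBalancedOn S ↔ B.F1 = 0 ∧ B.F2 = 0) ∧
        (B.DynamicallyBalancedOn S ↔ B.LinearConditionsIII B.l2)) ∧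
    (∀ l d : ℝ, 0 < l → 0 < d →
      (DynamicBalancingPossible d l l d {z | z.1 ≠ 1} ↔ √2 * l < d)) ∧
    -- case III, mode B
    (∀ B : FourBar, B.CaseIII →
      ∀ S : Set (ℂ × ℂ), S ⊆ B.configs ∩ {z | z.1 = 1} → S.Infinite →
        (B.StaticallyBalancedOn S ↔ B.F2 = 0) ∧ ¬ B.DynamicallyBalancedOn S) ∧
    -- case IV, mode A
    (∀ B : FourBar, B.CaseIV → B.l1 ≠ B.l2 →
      ∀ S : Set (ℂ × ℂ), S ⊆ B.configs ∩ {z | z.2 ≠ -1} → S.Infinite →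
        (B.StaticallyBalancedOn S ↔ B.F1 = 0 ∧ B.F2 = 0) ∧
        (B.DynamicallyBalancedOn S ↔ B.LinearConditionsIV B.l1)) ∧
    (∀ l d : ℝ, 0 < l → 0 < d →
      (DynamicBalancingPossible l d l d {z | z.2 ≠ -1} ↔ √2 * l < d)) ∧
    -- case IV, mode B
    (∀ B : FourBar, B.CaseIV →
      ∀ S : Set (ℂ × ℂ), S ⊆ B.configs ∩ {z | z.2 = -1} → S.Infinite →
        (B.StaticallyBalancedOn S ↔ B.F1 = 0) ∧ ¬ B.DynamicallyBalancedOn S) ∧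
    -- all lengths equal
    (∀ B : FourBar, B.CaseV →
      (∀ z ∈ B.configs, z.1 = z.2 ∨ z.1 = 1 ∨ z.2 = -1) ∧
      ∀ S : Set (ℂ × ℂ), S ⊆ B.configs → S.Infinite → ¬ B.DynamicallyBalancedOn S) := by
  refine ⟨fun B => B.irreducible_loopPoly_iff, ?_, ?_, ?_, ?_, ?_, ?_, ?_, ?_, ?_, ?_, ?_⟩
  · intro B hB S hS hS'
    obtain ⟨h2, h3, h4⟩ := B.irreducible_loopPoly_iff.1 hB
    exact ⟨staticallyBalancedOn_iff_F_eq_zero hS hS' (fun h => h2 h.1) (fun h => h3 h.1)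
      (fun h => h4 h.1), not_dynamicallyBalancedOn hS hS' h2 h3 h4⟩
  · exact fun B h hne S hS hS' => dynamicallyBalancedOn_iff_of_caseII h hne
      (fun z hz => (hS hz).1) hS' fun z hz => (hS hz).2
  · exact fun l d hl hd => dynamicBalancingPossible_antiparallelogram_iff hl hd
  · exact fun B h S hS hS' =>
      ⟨staticallyBalancedOn_iff_of_fst_eq_snd (fun z hz => (hS hz).1) hS' fun z hz => (hS hz).2,
        not_dynamicallyBalancedOn_parallelogram h (fun z hz => (hS hz).1) hS' fun z hz => (hS hz).2⟩
  · exact fun B h hne S hS hS' => dynamicallyBalancedOn_iff_of_caseIII h hne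
      (fun z hz => (hS hz).1) hS' fun z hz => (hS hz).2
  · exact fun l d hl hd => dynamicBalancingPossible_deltoid_iff hl hd
  · exact fun B h S hS hS' =>
      ⟨staticallyBalancedOn_iff_of_fst_eq_one (fun z hz => (hS hz).1) hS' fun z hz => (hS hz).2,
        not_dynamicallyBalancedOn_deltoid h (fun z hz => (hS hz).1) hS' fun z hz => (hS hz).2⟩
  · exact fun B h hne S hS hS' => dynamicallyBalancedOn_iff_of_caseIV h hne
      (fun z hz => (hS hz).1) hS' fun z hz => (hS hz).2
  · exact fun l d hl hd => dynamicBalancingPossible_deltoid'_iff hl hd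
  · exact fun B h S hS hS' =>
      ⟨staticallyBalancedOn_iff_of_snd_eq_neg_one (fun z hz => (hS hz).1) hS' fun z hz => (hS hz).2,
        not_dynamicallyBalancedOn_deltoid' h (fun z hz => (hS hz).1) hS' fun z hz => (hS hz).2⟩
  · exact fun B h => ⟨fun z hz => h.cases hz, fun S hS hS' =>
      not_dynamicallyBalancedOn_of_caseV h hS hS'⟩
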